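/- **Model.** Let $M\ge 2$. At time $t=1,2,\dots$ an $M$-antenna transmitter sends $x_t\in\mathbb C^M$ with $\mathbb E\|x_t\|^2\le P$, and users $1,2$ receive $$y^{(1)}_t=h_t^{\mathsf T}x_t+z^{(1)}_t,\qquad y^{(2)}_t=g_t^{\mathsf T}x_t+z^{(2)}_t,$$ with noises $z^{(i)}_t$ i.i.d. $\mathcal{CN}(0,1)$, independent of everything else. The random channel vectors $h_t,g_t\in\mathbb C^M$ have zero mean and identity covariance (arbitrary correlation in time), and for each $t$ they are almost surely linearly independent. For each SNR $P$ there is a feedback (CSIT) process: $\hat h_{t,t'},\hat g_{t,t'}$ (depending on $P$) are the estimates of $h_t,g_t$ that the transmitter has at time $t'$. Each error vector $h_t-\hat h_{t,t'}$, $g_t-\hat g_{t,t'}$ has i.i.d. zero-mean circularly-symmetric complex Gaussian entries, and each of the current errors $h_t-\hat h_{t,t}$, $g_t-\hat g_{t,t}$ is independent of all estimates formed at times $t'\le t$. **Quality exponents.** Fix a finite integer $\eta>0$ and suppose that the limits $$\alpha^{(1)}_t=-\lim_{P\to\infty}\frac{\log\mathbb E\|h_t-\hat h_{t,t}\|^2}{\log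 P},\qquad \beta^{(1)}_t=-\lim_{P\to\infty}\frac{\log\mathbb E\|h_t-\hat h_{t,t+\eta}\|^2}{\log P}$$ exist for every $t$, likewise $\alpha^{(2)}_t,\beta^{(2)}_t$ with $g$ in place of $h$ (the error powers being positive for large $P$), and that $0\le\alpha^{(i)}_t\le\beta^{(i)}_t\le1$. Suppose that $\bar\alpha^{(i)},\bar\beta^{(i)}$ are the long-term averages of these sequences in the sense that $\frac1T\sum_{t=\tau+1}^{\tau+T}\alpha^{(i)}_t\to\bar\alpha^{(i)}$ and $\frac1T\sum_{t=\tau+1}^{\tau+T}\beta^{(i)}_t\to\bar\beta^{(i)}$ as $T\to\infty$, uniformly in $\tau\ge0$. **DoF region.** A code of length $n$ with $m_1,m_2$ messages for the two users (uniform, independent of each other, of the channels, the estimates and the noise) chooses $x_t$ as a function of the two messages and of the estimates $\hat h_{\tau,t'},\hat g_{\tau,t'}$, $\tau\le n$, $t'\le t$; user $i$ decodes its message from $y^{(i)}_1,\dots,y^{(i)}_n$ and from all channel vectors and all estimates with indices at most $n$. The DoF region is the set of pairs $(d_1,d_2)$ with $d_1,d_2\ge0$ such that for every $\varepsilon>0$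 and every sufficiently large $n$ there are codes of length $n$, one for each $P$, that obey the power constraint and have rates $\frac1n\log m_i\ge(d_i-\varepsilon)\log P$ ($i=1,2$) for all large $P$, and whose probability that some user decodes wrongly tends to $0$ as $P\to\infty$. **Proposition.** The DoF region contains the polygon of all $(d_1,d_2)$ with $d_1,d_2\ge0$ and $$d_1\le1,\quad d_2\le1,\quad 2d_1+d_2\le2+\bar\alpha^{(1)},\quad 2d_2+d_1\le2+\bar\alpha^{(2)},\quad d_1+d_2\le1+\min\{\bar\beta^{(1)},\bar\beta^{(2)}\}.$$ -/

import Mathlib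

open MeasureTheory ProbabilityTheory Filter Topology
open scoped ENNReal NNReal ComplexConjugate

noncomputable section

namespace MISOBC

/-- The space `ℂ^M` with its Euclidean norm. -/
abbrev CVec (M : ℕ) : Type := EuclideanSpace ℂ (Fin M)

/-- The circularly-symmetric complex Gaussian law with mean `0` and power `E|z|² = v`: real and
imaginary parts are independent real Gaussians of variance `v / 2`. -/
def complexGaussian (v : ℝ≥0) : Measure ℂ :=
  ((gaussianReal 0 (v / 2)).prod (gaussianReal 0 (v / 2))).map
    (fun p : ℝ × ℝ => (p.1 : ℂ) + (p.2 : ℂ) * Complex.I)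

instance (v : ℝ≥0) : IsProbabilityMeasure (complexGaussian v) :=
  Measure.isProbabilityMeasure_map (by fun_prop)

/-- A two-user fading process with `M` transmit antennas together with its CSIT process. Users are
indexed by `Fin 2`, and the time slots `1, 2, 3, …` by `0, 1, 2, …`. The fading process does not
depend on the SNR `P`, the estimates do. -/
structure FadingCSIT (M : ℕ) {Ω : Type*} [MeasurableSpace Ω] (μ : Measure Ω) where
  /-- `H i t` is the channel vector of user `i` at time `t`. -/
  H : Fin 2 → ℕ → Ω → CVec M
  /-- `Hhat P i t t'` is the estimate of `H i t` that the transmitter has at time `t'` when the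
  SNR is `P`. -/
  Hhat : ℝ → Fin 2 → ℕ → ℕ → Ω → CVec M
  measurable_H : ∀ i t, Measurable (H i t)
  measurable_Hhat : ∀ P i t t', Measurable (Hhat P i t t')
  /-- The entries have finite second moments, zero mean and identity covariance. -/
  memLp_H : ∀ i t, MemLp (H i t) 2 μ
  mean_H : ∀ i t k, ∫ ω, H i t ω k ∂μ = 0
  cov_H : ∀ i t k l, ∫ ω, H i t ω k * conj (H i t ω l) ∂μ = if k = l then 1 else 0
  /-- At each time the two users' channels are almost surely linearly independent. -/
  linearIndependent_H : ∀ t, ∀ᵐ ω ∂μ, LinearIndependent ℂ ![H 0 t ω, H 1 t ω]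
  /-- The `M` entries of each estimation error vector are i.i.d. circularly-symmetric complex
  Gaussian with mean zero. -/
  gaussian_error : ∀ P, 0 < P → ∀ i t t', ∃ v : ℝ≥0,
    μ.map (fun ω => fun k : Fin M => H i t ω k - Hhat P i t t' ω k) =
      Measure.pi (fun _ : Fin M => complexGaussian v)
  /-- The current estimation error is independent of all current and past estimates. -/
  indep_error : ∀ P, 0 < P → ∀ i t,
    IndepFun (fun ω => H i t ω - Hhat P i t t ω)
      (fun ω => fun (j : Fin 2) (τ : ℕ) (t' : Set.Iic t) => Hhat P j τ t' ω) μ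

/-- `a = - lim_{P → ∞} log E‖e_P‖² / log P`, where the error power is positive and finite for large
`P` (the Bochner integral of a non-integrable function is `0`). -/
def IsQualityExponent {M : ℕ} {Ω : Type*} [MeasurableSpace Ω] (μ : Measure Ω)
    (e : ℝ → Ω → CVec M) (a : ℝ) : Prop :=
  (∀ᶠ P in atTop, 0 < ∫ ω, ‖e P ω‖ ^ 2 ∂μ) ∧
    Tendsto (fun P : ℝ => -(Real.logb 2 (∫ ω, ‖e P ω‖ ^ 2 ∂μ) / Real.logb 2 P)) atTop (𝓝 a)

/-- The averages of `a` over all sufficiently long windows of consecutive times approach `abar`,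
uniformly in the position of the window. For windows starting at the first time slot this says that
`abar` is the long-term average of `a`. -/
def HasWindowAverage (a : ℕ → ℝ) (abar : ℝ) : Prop :=
  ∀ ε : ℝ, 0 < ε → ∃ T₀ : ℕ, ∀ T : ℕ, T₀ ≤ T → ∀ τ : ℕ,
    |(∑ t ∈ Finset.range T, a (τ + t)) / (T : ℝ) - abar| ≤ ε

/-- A code of block length `n` with `m i` messages for user `i`. The input at time `t` is a function
of the messages and of the estimates that have arrived up to time `t`; each decoder sees its own
received signal, all the channel states and all the estimates. -/
structure Code (M n : ℕ) (m : Fin 2 → ℕ) where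
  enc : (t : Fin n) → ((i : Fin 2) → Fin (m i)) → (Fin 2 → Fin n → Set.Iic t → CVec M) → CVec M
  dec : (i : Fin 2) → (Fin n → ℂ) → (Fin 2 → Fin n → CVec M) →
    (Fin 2 → Fin n → Fin n → CVec M) → Fin (m i)
  measurable_enc : ∀ t w, Measurable (enc t w)
  measurable_dec : ∀ i, Measurable
    (fun p : (Fin n → ℂ) × (Fin 2 → Fin n → CVec M) × (Fin 2 → Fin n → Fin n → CVec M) =>
      dec i p.1 p.2.1 p.2.2)

/-- The law of the noise: i.i.d. unit-power complex Gaussians over users and time slots. -/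
def noiseLaw (n : ℕ) : Measure (Fin 2 → Fin n → ℂ) :=
  Measure.pi fun _ => Measure.pi fun _ => complexGaussian 1

section

variable {M n : ℕ} {m : Fin 2 → ℕ} {Ω : Type*} [MeasurableSpace Ω] {μ : Measure Ω}

/-- The transmitted vector at time `t` for the message pair `w`, at SNR `P`. -/
def Code.input (c : Code M n m) (S : FadingCSIT M μ) (P : ℝ) (w : (i : Fin 2) → Fin (m i))
    (t : Fin n) (ω : Ω) : CVec M :=
  c.enc t w (fun j τ t' => S.Hhat P j (τ : ℕ) ((t' : Fin n) : ℕ) ω)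

/-- The power constraint `E‖x_t‖² ≤ P` at every time `t`, for uniform messages independent of the
fading and CSIT process. -/
def Code.PowerConstraint (c : Code M n m) (S : FadingCSIT M μ) (P : ℝ) : Prop :=
  ∀ t : Fin n,
    (∑ w : (i : Fin 2) → Fin (m i), ∫⁻ ω, ‖c.input S P w t ω‖ₑ ^ 2 ∂μ) /
      ((∏ i, m i : ℕ) : ℝ≥0∞) ≤ ENNReal.ofReal P

/-- The received signal of user `i` at time `t`: `(H i t)ᵀ x_t + z i t` (transpose, without
conjugation). -/
def Code.output (c : Code M n m) (S : FadingCSIT M μ) (P : ℝ) (w : (i : Fin 2) → Fin (m i))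
    (i : Fin 2) (ω : Ω) (z : Fin 2 → Fin n → ℂ) (t : Fin n) : ℂ :=
  (∑ k : Fin M, S.H i (t : ℕ) ω k * c.input S P w t ω k) + z i t

/-- The message that user `i` decodes. -/
def Code.decoded (c : Code M n m) (S : FadingCSIT M μ) (P : ℝ) (w : (i : Fin 2) → Fin (m i))
    (i : Fin 2) (ω : Ω) (z : Fin 2 → Fin n → ℂ) : Fin (m i) :=
  c.dec i (c.output S P w i ω z) (fun j τ => S.H j (τ : ℕ) ω)
    (fun j τ t' => S.Hhat P j (τ : ℕ) (t' : ℕ) ω)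

/-- The probability that some user decodes its message wrongly, for uniform messages, where the
messages, the noise and the fading and CSIT process are independent. -/
def Code.errorProb (c : Code M n m) (S : FadingCSIT M μ) (P : ℝ) : ℝ≥0∞ :=
  (∑ w : (i : Fin 2) → Fin (m i),
    (μ.prod (noiseLaw n)) {p | ∃ i, c.decoded S P w i p.1 p.2 ≠ w i}) /
      ((∏ i, m i : ℕ) : ℝ≥0∞)

/-- The DoF region: the nonnegative pairs `(d 0, d 1)` such that, for every `ε > 0` and every
sufficiently large block length `n`, there are codes of length `n`, one for each SNR `P`, that obey
the power constraint, have rates `(1/n) log (m i)` of at least `(d i - ε) log P` for all large `P`,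
and have an error probability that vanishes as `P → ∞`. -/
def dofRegion (S : FadingCSIT M μ) : Set (Fin 2 → ℝ) :=
  {d | (∀ i, 0 ≤ d i) ∧
    ∀ ε : ℝ, 0 < ε → ∀ᶠ n : ℕ in atTop,
      ∃ (m : ℝ → Fin 2 → ℕ) (c : (P : ℝ) → Code M n (m P)),
        (∀ᶠ P : ℝ in atTop, (c P).PowerConstraint S P ∧
          ∀ i, (d i - ε) * Real.logb 2 P ≤ Real.logb 2 (m P i : ℝ) / (n : ℝ)) ∧
        Tendsto (fun P : ℝ => (c P).errorProb S P) atTop (𝓝 0)}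

end

end MISOBC

end

noncomputable section

namespace MISOBC

/-! The scheme is block-Markov with backward decoding. In slot `t`, user `i` is sent two private
symbols. One has power `P ^ δ` and is zero-forced against the current estimate of the other user
`k`; the other has power `P ^ max (δ - α) 0` and is sent freely. Here `δ`, `α`, `β` are the
exponents of `k`. Up to factors `P ^ κ`, with `κ` arbitrarily small, both symbols reach `k` with
power at most `P ^ max (δ - α) 0`. Since `δ ≤ β`, the transmitter can compute this interference up
to noise level once the delayed estimate has arrived. It rounds the interference and puts it,
together with fresh common messages, into a strong common codeword of the next block, sent along a
fixed direction. The idle slots between blocks let the delayed estimates arrive.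

The last block carries no private symbols. Going backwards, each common codeword reveals the
interference of the preceding block at both receivers. A user subtracts its own interference and
uses the interference at the other user as a second equation for its two private symbols; the two
channels being independent, the system is solvable (`Scheme.payload_eq_of_output_close`).

Let `δ` have average `dbar` for both users, write `q k = max (dbar - αbar k) 0`, and let `C i` be
the common rates. The common codeword is decoded above private signals of average exponent `dbar`,
so it needs `C 0 + C 1 + q 0 + q 1 + dbar ≤ 1`, and user `i` gets `C i + dbar + q (1 - i)`. Taking
`dbar` close to `d 0 + d 1 - 1` yields the polygon (`exists_power_profile`, `exists_rate_split`).

Decoding is a deterministic separation statement on good channel states: payloads whose noiseless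
outputs are within `2 * P ^ κ` coincide. The constellations are square grids, and the codebooks come
from a greedy packing argument (`exists_codebook`). Probability enters only through good states and
bounded noise having probability tending to one (`highProb_goodSlot`, `highProb_noise_le`). -/

/-! ### From separated noiseless outputs to codes -/

/-- The full array of estimates, extended by zero, that is known from the estimates of the first
`n` channel states received up to time `t`. -/
def extendCSIT {M n : ℕ} (t : Fin n) (e : Fin 2 → Fin n → Set.Iic t → CVec M) :
    Fin 2 → ℕ → ℕ → CVec M :=
  fun j τ t' => if h : ∃ _ : τ < n, ∃ ht' : t' < n, (⟨t', ht'⟩ : Fin n) ≤ t then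
    e j ⟨τ, h.1⟩ ⟨⟨t', h.2.1⟩, h.2.2⟩ else 0

lemma measurable_extendCSIT {M n : ℕ} (t : Fin n) :
    Measurable (extendCSIT (M := M) t) := by
  refine measurable_pi_iff.2 fun j => measurable_pi_iff.2 fun τ => measurable_pi_iff.2 fun t' => ?_
  by_cases h : ∃ _ : τ < n, ∃ ht' : t' < n, (⟨t', ht'⟩ : Fin n) ≤ t
  · simp only [extendCSIT, h, dite_true]
    fun_prop
  · simp only [extendCSIT, h, dite_false]
    fun_prop

/-- A family of causal, bounded encoding maps for which, on a set `G` of channel states, noiseless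
outputs within distance `2 * r` of each other determine the message, gives a code. -/
theorem exists_code_of_separation {M n : ℕ} {Ω : Type*} [MeasurableSpace Ω] {μ : Measure Ω}
    [IsProbabilityMeasure μ] (S : FadingCSIT M μ) {P r : ℝ} (W : Fin 2 → Type)
    [∀ i, Fintype (W i)] [∀ i, Nonempty (W i)]
    (x : ℕ → (∀ i, W i) → (Fin 2 → ℕ → ℕ → CVec M) → CVec M)
    (hmeas : ∀ t w, Measurable (x t w))
    (hcausal : ∀ t w E E', (∀ j τ t', τ ≤ t → t' ≤ t → E j τ t' = E' j τ t') →
      x t w E = x t w E')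
    (hpow : ∀ t w E, ‖x t w E‖ ^ 2 ≤ P) (G : Set Ω)
    (hsep : ∀ ω ∈ G, ∀ i w w', (∀ t < n,
      ‖∑ k, S.H i t ω k * x t w (fun j τ t' => S.Hhat P j τ t' ω) k -
        ∑ k, S.H i t ω k * x t w' (fun j τ t' => S.Hhat P j τ t' ω) k‖ ≤ 2 * r) → w i = w' i) :
    ∃ c : Code M n (fun i => Fintype.card (W i)), c.PowerConstraint S P ∧
      c.errorProb S P ≤ μ Gᶜ + noiseLaw n {z | ∀ i t, ‖z i t‖ ≤ r}ᶜ := by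
  classical
  let e : ∀ i, Fin (Fintype.card (W i)) ≃ W i := fun i => (Fintype.equivFin (W i)).symm
  let Msg := (i : Fin 2) → Fin (Fintype.card (W i))
  let ew : Msg → ∀ i, W i := fun w i => e i (w i)
  have hcausal' : ∀ (t : Fin n) (w : ∀ i, W i) (E : Fin 2 → ℕ → ℕ → CVec M),
      x t w (extendCSIT t fun j τ t' => E j τ ((t' : Fin n) : ℕ)) = x t w E := by
    intro t w E
    apply hcausal
    intro j τ t' h1 h2
    have : ∃ _ : τ < n, ∃ ht' : t' < n, (⟨t', ht'⟩ : Fin n) ≤ t :=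
      ⟨h1.trans_lt t.2, h2.trans_lt t.2, h2⟩
    simp [extendCSIT, this]
  let cons : Msg → (Fin 2) → (Fin n → ℂ) × (Fin 2 → Fin n → CVec M) ×
      (Fin 2 → Fin n → Fin n → CVec M) → Prop := fun w i p =>
    ∀ t : Fin n, ‖p.1 t - ∑ k, p.2.1 i t k *
      x t (ew w) (extendCSIT t fun j τ t' => p.2.2 j τ t') k‖ ≤ r
  have hcons : ∀ w i, Measurable (cons w i) := by
    intro w i
    refine measurableSet_setOfPred.1 ?_
    simp only [cons, Set.ofPred_forall]
    refine MeasurableSet.iInter fun t => measurableSet_le (Measurable.norm ?_) measurable_const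
    have hx : Measurable fun p : (Fin n → ℂ) × (Fin 2 → Fin n → CVec M) ×
      (Fin 2 → Fin n → Fin n → CVec M) =>
        x t (ew w) (extendCSIT t fun j τ t' => p.2.2 j τ t') := by
      refine (hmeas t (ew w)).comp ((measurable_extendCSIT t).comp ?_)
      fun_prop
    refine Measurable.sub (by fun_prop) (Finset.measurable_sum _ fun k _ => Measurable.mul ?_ ?_)
    · have : Measurable fun p : (Fin n → ℂ) × (Fin 2 → Fin n → CVec M) ×
        (Fin 2 → Fin n → Fin n → CVec M) => p.2.1 i t := by fun_prop
      fun_prop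
    · exact (by fun_prop : Measurable fun v : CVec M => v k).comp hx
  have hne : ∀ i, 0 < Fintype.card (W i) := fun i => Fintype.card_pos
  -- The decoder picks any message pair consistent with its observation and keeps its own component.
  -- The domain of `F i` is finite, which makes this arbitrary choice measurable.
  let F : ∀ i, (Msg → Prop) → Fin (Fintype.card (W i)) := fun i s =>
    if h : ∃ w, s w then h.choose i else ⟨0, hne i⟩
  let c : Code M n (fun i => Fintype.card (W i)) :=
    { enc := fun t w est => x t (ew w) (extendCSIT t est)
      dec := fun i y h est => F i fun w => cons w i (y, h, est)
      measurable_enc := fun t w => (hmeas t (ew w)).comp (measurable_extendCSIT t)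
      measurable_dec := fun i => (Measurable.of_discrete (f := F i)).comp
        (measurable_pi_iff.2 fun w => hcons w i) }
  have hinput : ∀ w t ω, c.input S P w t ω = x t (ew w) (fun j τ t' => S.Hhat P j τ t' ω) :=
    fun w t ω => hcausal' t (ew w) fun j τ t' => S.Hhat P j τ t' ω
  have hprod : ((∏ i, Fintype.card (W i) : ℕ) : ℝ≥0∞) ≠ 0 := by
    exact_mod_cast (Finset.prod_pos fun i _ => hne i).ne'
  have havg : ∀ (g : Msg → ℝ≥0∞) (b : ℝ≥0∞), (∀ w, g w ≤ b) →
      (∑ w, g w) / ((∏ i, Fintype.card (W i) : ℕ) : ℝ≥0∞) ≤ b := by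
    intro g b hg
    refine ENNReal.div_le_of_le_mul ?_
    refine (Finset.sum_le_sum fun w _ => hg w).trans ?_
    simp [Msg, mul_comm]
  refine ⟨c, fun t => havg _ _ fun w => ?_, havg _ _ fun w => ?_⟩
  · calc ∫⁻ ω, ‖c.input S P w t ω‖ₑ ^ 2 ∂μ ≤ ∫⁻ _, ENNReal.ofReal P ∂μ := by
          refine lintegral_mono fun ω => ?_
          rw [hinput, ← ofReal_norm, ← ENNReal.ofReal_pow (norm_nonneg _)]
          exact ENNReal.ofReal_le_ofReal (hpow _ _ _)
      _ = ENNReal.ofReal P := by simp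
  · have hsub : {p : Ω × (Fin 2 → Fin n → ℂ) | ∃ i, c.decoded S P w i p.1 p.2 ≠ w i} ⊆
        (Gᶜ ×ˢ Set.univ) ∪ (Set.univ ×ˢ {z | ∀ i t, ‖z i t‖ ≤ r}ᶜ) := by
      rintro ⟨ω, z⟩ ⟨i, hi⟩
      by_contra hcon
      simp only [Set.mem_union, Set.mem_prod, Set.mem_compl_iff, Set.mem_univ, and_true, true_and,
        not_or, not_not, Set.mem_ofPred_eq] at hcon
      obtain ⟨hG, hz⟩ := hcon
      apply hi
      have key : ∀ w', cons w' i (c.output S P w i ω z, (fun j τ => S.H j (τ : ℕ) ω),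
          (fun j τ t' => S.Hhat P j (τ : ℕ) (t' : ℕ) ω)) ↔ ∀ t : Fin n,
          ‖∑ k, S.H i t ω k * x t (ew w) (fun j τ t' => S.Hhat P j τ t' ω) k + z i t -
          ∑ k, S.H i t ω k * x t (ew w') (fun j τ t' => S.Hhat P j τ t' ω) k‖ ≤ r := by
        intro w'
        simp only [cons]
        refine forall_congr' fun t => ?_
        rw [hcausal' t (ew w') (fun j τ t' => S.Hhat P j τ t' ω)]
        simp only [Code.output, hinput]
      have hex : ∃ w', cons w' i (c.output S P w i ω z, (fun j τ => S.H j (τ : ℕ) ω),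
          (fun j τ t' => S.Hhat P j (τ : ℕ) (t' : ℕ) ω)) :=
        ⟨w, (key w).2 fun t => by simpa using hz i t⟩
      have hd : c.decoded S P w i ω z = hex.choose i := by
        simp only [Code.decoded, c, F]
        exact dif_pos hex
      rw [hd]
      have h1 := (key _).1 hex.choose_spec
      -- The true and the chosen pair both explain the output up to `r`, hence their noiseless
      -- outputs differ by at most `2 * r`.
      have := hsep ω hG i (ew w) (ew hex.choose) fun t ht => by
        have h2 := h1 ⟨t, ht⟩
        have h3 := hz i ⟨t, ht⟩
        simp only at h2 h3
        calc _ = ‖(∑ k, S.H i t ω k * x t (ew w) (fun j τ t' => S.Hhat P j τ t' ω) k + z i ⟨t, ht⟩ -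
          ∑ k, S.H i t ω k * x t (ew hex.choose) (fun j τ t' => S.Hhat P j τ t' ω) k)
            - z i ⟨t, ht⟩‖ := by congr 1; ring
          _ ≤ r + r := (norm_sub_le _ _).trans (add_le_add h2 h3)
          _ = 2 * r := by ring
      exact ((e i).injective this).symm
    have : IsProbabilityMeasure (noiseLaw n) := by unfold noiseLaw; infer_instance
    refine (measure_mono hsub).trans ((measure_union_le _ _).trans ?_)
    rw [Measure.prod_prod, Measure.prod_prod]
    simp

/-- Membership in the DoF region from codes at all large SNRs with vanishing error bounds. -/
theorem mem_dofRegion_of_eventually {M : ℕ} {Ω : Type*} [MeasurableSpace Ω] {μ : Measure Ω}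
    (S : FadingCSIT M μ) {d : Fin 2 → ℝ} (hd : ∀ i, 0 ≤ d i)
    (h : ∀ ε : ℝ, 0 < ε → ε ≤ 1 → ∀ᶠ n : ℕ in atTop, ∃ b : ℝ → ℝ≥0∞, Tendsto b atTop (𝓝 0) ∧
      ∀ᶠ P : ℝ in atTop, ∃ (m : Fin 2 → ℕ) (c : Code M n m), c.PowerConstraint S P ∧
        (∀ i, (d i - ε) * Real.logb 2 P ≤ Real.logb 2 (m i : ℝ) / (n : ℝ)) ∧
        c.errorProb S P ≤ b P) : d ∈ dofRegion S := by
  classical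
  refine ⟨hd, fun ε hε => ?_⟩
  filter_upwards [h (min ε 1) (by positivity) (min_le_right _ _)] with n hn
  obtain ⟨b, hb, hP⟩ := hn
  let c0 : Code M n (fun _ => 1) := ⟨fun _ _ _ => 0, fun _ _ _ _ => 0, fun _ _ => measurable_const,
    fun _ => measurable_const⟩
  let Q : ℝ → ((m : Fin 2 → ℕ) × Code M n m) → Prop := fun P mc => mc.2.PowerConstraint S P ∧
        (∀ i, (d i - min ε 1) * Real.logb 2 P ≤ Real.logb 2 (mc.1 i : ℝ) / (n : ℝ)) ∧
        mc.2.errorProb S P ≤ b P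
  -- At the small SNRs where no good code is promised, the trivial code with one message per user
  -- fills in.
  let f : ℝ → (m : Fin 2 → ℕ) × Code M n m := fun P =>
    if h : ∃ mc, Q P mc then h.choose else ⟨fun _ => 1, c0⟩
  have hf : ∀ᶠ P in atTop, Q P (f P) := by
    filter_upwards [hP] with P ⟨m, c, hc⟩
    have hex : ∃ mc, Q P mc := ⟨⟨m, c⟩, hc⟩
    simp only [f, hex, dite_true]
    exact hex.choose_spec
  refine ⟨fun P => (f P).1, fun P => (f P).2, ?_, ?_⟩
  · filter_upwards [hf, eventually_ge_atTop 1] with P hP h1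
    refine ⟨hP.1, fun i => le_trans ?_ (hP.2.1 i)⟩
    exact mul_le_mul_of_nonneg_right (by linarith [min_le_left ε 1])
      (Real.logb_nonneg (by norm_num) h1)
  · exact tendsto_of_tendsto_of_tendsto_of_le_of_le' tendsto_const_nhds hb
      (Eventually.of_forall fun _ => zero_le) (hf.mono fun P hP => hP.2.2)

/-! ### Events of high probability -/

/-- The event `p P` has probability tending to `1` as `P → ∞`. -/
def HighProb {Ω : Type*} [MeasurableSpace Ω] (μ : Measure Ω) (p : ℝ → Ω → Prop) : Prop :=
  Tendsto (fun P => μ {ω | p P ω}ᶜ) atTop (𝓝 0)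

section HighProb

variable {Ω : Type*} [MeasurableSpace Ω] {μ : Measure Ω}

lemma HighProb.mono {p q : ℝ → Ω → Prop} (hp : HighProb μ p)
    (h : ∀ᶠ P in atTop, ∀ᵐ ω ∂μ, p P ω → q P ω) : HighProb μ q := by
  refine tendsto_of_tendsto_of_tendsto_of_le_of_le' tendsto_const_nhds hp
    (Eventually.of_forall fun _ => zero_le) (h.mono fun P hP => ?_)
  refine measure_mono_ae ?_
  filter_upwards [hP] with ω hω h1 h2
  exact h1 (hω h2)

lemma HighProb.forall {ι : Type*} [Finite ι] {p : ι → ℝ → Ω → Prop} (hp : ∀ i, HighProb μ (p i)) :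
    HighProb μ fun P ω => ∀ i, p i P ω := by
  have := Fintype.ofFinite ι
  have h : Tendsto (fun P => ∑ i, μ {ω | p i P ω}ᶜ) atTop (𝓝 (∑ _i : ι, 0)) :=
    tendsto_finsetSum _ fun i _ => hp i
  rw [Finset.sum_const_zero] at h
  refine tendsto_of_tendsto_of_tendsto_of_le_of_le tendsto_const_nhds h
    (fun _ => zero_le) fun P => ?_
  refine le_trans (measure_mono ?_) (measure_iUnion_fintype_le μ fun i => {ω | p i P ω}ᶜ)
  intro ω hω
  simpa using hω

lemma HighProb.and {p q : ℝ → Ω → Prop} (hp : HighProb μ p) (hq : HighProb μ q) :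
    HighProb μ fun P ω => p P ω ∧ q P ω := by
  have : HighProb μ fun P ω => ∀ b : Bool, (cond b (p P ω) (q P ω)) :=
    HighProb.forall (p := fun b P ω => cond b (p P ω) (q P ω)) (by rintro (_ | _); exacts [hq, hp])
  refine this.mono (Eventually.of_forall fun P => Eventually.of_forall fun ω h => ?_)
  exact ⟨h true, h false⟩

/-- Continuity from above of the measure: the events `X > r` decrease to the empty set. It suits
channels and noise, whose laws do not depend on `P`; estimation errors need a rate instead. -/
lemma highProb_le_of_tendsto [IsProbabilityMeasure μ] {X : Ω → ℝ} (hX : Measurable X) {g : ℝ → ℝ}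
    (hg : Tendsto g atTop atTop) : HighProb μ fun P ω => X ω ≤ g P := by
  have h := tendsto_measure_iInter_atTop (μ := μ) (s := fun r : ℝ => {ω | X ω ≤ r}ᶜ)
    (fun r => (measurableSet_le hX measurable_const).compl.nullMeasurableSet)
    (fun r r' hr ω hω h => hω (le_trans h hr)) ⟨0, measure_ne_top _ _⟩
  have h0 : (⋂ r : ℝ, {ω | X ω ≤ r}ᶜ) = ∅ := by
    rw [Set.eq_empty_iff_forall_notMem]
    intro ω hω
    exact Set.mem_iInter.1 hω (X ω) (le_refl (X ω))
  rw [h0, measure_empty] at h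
  exact h.comp hg

lemma highProb_norm_ge_of_tendsto [IsProbabilityMeasure μ] {X : Ω → ℂ} (hX : Measurable X)
    (h0 : ∀ᵐ ω ∂μ, X ω ≠ 0) {g : ℝ → ℝ} (hg : Tendsto g atTop atTop) :
    HighProb μ fun P ω => 1 ≤ g P * ‖X ω‖ := by
  refine (highProb_le_of_tendsto (X := fun ω => ‖X ω‖⁻¹) hX.norm.inv hg).mono
    (Eventually.of_forall fun P => h0.mono fun ω h1 h2 => ?_)
  have : 0 < ‖X ω‖ := norm_pos_iff.2 h1
  rwa [inv_le_iff_one_le_mul₀ this] at h2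

/-- Markov's inequality for `‖e P‖ ^ 2`, whose mean is at most `P ^ (κ - a)`, at the level `P ^ (-a
+ 2 * κ)`: the exceptional probability is at most `P ^ (-κ)`. -/
lemma IsQualityExponent.highProb [IsProbabilityMeasure μ] {M : ℕ} {e : ℝ → Ω → CVec M} {a : ℝ}
    (h : IsQualityExponent μ e a) {κ : ℝ} (hκ : 0 < κ) :
    HighProb μ fun P ω => ‖e P ω‖ ≤ P ^ (-a / 2 + κ) := by
  have hlim : Tendsto (fun P : ℝ => ENNReal.ofReal (P ^ (-κ))) atTop (𝓝 0) := by
    simpa using ENNReal.tendsto_ofReal (tendsto_rpow_neg_atTop hκ)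
  refine tendsto_of_tendsto_of_tendsto_of_le_of_le' tendsto_const_nhds hlim
    (Eventually.of_forall fun _ => zero_le) ?_
  filter_upwards [h.1, h.2.eventually (lt_mem_nhds (show a - κ < a by linarith)),
    eventually_gt_atTop 1] with P hpos hlog hP
  have hP0 : 0 < P := by linarith
  have hlogP : 0 < Real.logb 2 P := Real.logb_pos (by norm_num) hP
  set I := ∫ ω, ‖e P ω‖ ^ 2 ∂μ with hI
  -- A positive Bochner integral certifies integrability, because an undefined one is zero.
  have hint : Integrable (fun ω => ‖e P ω‖ ^ 2) μ := by
    by_contra hcon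
    exact hpos.ne' (integral_undef hcon)
  have hIle : I ≤ P ^ (κ - a) := by
    have h1 : Real.logb 2 I / Real.logb 2 P < κ - a := by linarith
    rw [div_lt_iff₀ hlogP, ← Real.logb_rpow_eq_mul_logb_of_pos hP0] at h1
    exact ((Real.logb_lt_logb_iff (by norm_num) hpos (Real.rpow_pos_of_pos hP0 _)).1 h1).le
  have hM := mul_meas_ge_le_integral_of_nonneg (μ := μ) (f := fun ω => ‖e P ω‖ ^ 2)
    (Eventually.of_forall fun ω => by positivity) hint (P ^ (-a + 2 * κ))
  have hq : 0 < P ^ (-a + 2 * κ) := Real.rpow_pos_of_pos hP0 _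
  have hM2 : μ.real {ω | P ^ (-a + 2 * κ) ≤ ‖e P ω‖ ^ 2} ≤ P ^ (-κ) := by
    refine le_of_mul_le_mul_left ((hM.trans hIle).trans_eq ?_) hq
    rw [← Real.rpow_add hP0]
    congr 1
    ring
  rw [measureReal_def,
    ← ENNReal.le_ofReal_iff_toReal_le (measure_ne_top _ _) (by positivity)] at hM2
  refine le_trans (measure_mono fun ω hω => ?_) hM2
  have hω' : P ^ (-a / 2 + κ) < ‖e P ω‖ := not_le.1 hω
  have : P ^ (-a + 2 * κ) = (P ^ (-a / 2 + κ)) ^ 2 := by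
    rw [← Real.rpow_natCast, ← Real.rpow_mul hP0.le]
    congr 1
    push_cast
    ring
  show P ^ (-a + 2 * κ) ≤ ‖e P ω‖ ^ 2
  rw [this]
  gcongr

end HighProb

/-! ### Two generic transmit directions -/

/-- Countably many almost surely nonzero random vectors have a common vector that
is almost surely orthogonal to none of them. -/
lemma exists_generic_vector {M : ℕ} {Ω : Type*} [MeasurableSpace Ω] {μ : Measure Ω} [SFinite μ]
    {ι : Type*} [Countable ι] (q : ι → Ω → CVec M) (hq : ∀ j, Measurable (q j))
    (h0 : ∀ j, ∀ᵐ ω ∂μ, q j ω ≠ 0) : ∃ b : CVec M, ∀ j, ∀ᵐ ω ∂μ, ∑ k, q j ω k * b k ≠ 0 := by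
  have key : ∀ v : CVec M, v ≠ 0 → ∀ᵐ b : CVec M, ∑ k, v k * b k ≠ 0 := by
    intro v hv
    let φ : CVec M →ₗ[ℝ] ℂ :=
      { toFun := fun b => ∑ k, v k * b k
        map_add' := fun x y => by simp [mul_add, Finset.sum_add_distrib]
        map_smul' := fun r x => by simp [Finset.mul_sum, mul_left_comm] }
    have hne : LinearMap.ker φ ≠ ⊤ := by
      intro htop
      obtain ⟨k, hk⟩ : ∃ k, v k ≠ 0 := by
        by_contra! hcon
        exact hv (PiLp.ext hcon)
      have : EuclideanSpace.single k (1 : ℂ) ∈ LinearMap.ker φ := by rw [htop]; trivial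
      rw [LinearMap.mem_ker] at this
      apply hk
      simpa [φ] using this
    have h := Measure.addHaar_submodule (volume : Measure (CVec M)) (LinearMap.ker φ) hne
    rw [ae_iff]
    convert h using 2
    ext b
    simp [φ]
  have hm : ∀ j, MeasurableSet {x : Ω × CVec M | ∑ k, q j x.1 k * x.2 k ≠ 0} := by
    intro j
    refine (measurableSet_eq_fun (Finset.measurable_sum _ fun k _ => Measurable.mul ?_ ?_)
      measurable_const).compl
    · exact (by fun_prop : Measurable fun v : CVec M => v k).comp ((hq j).comp measurable_fst)
    · fun_prop
  have hall : ∀ᵐ b : CVec M, ∀ j, ∀ᵐ ω ∂μ, ∑ k, q j ω k * b k ≠ 0 := by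
    rw [ae_all_iff]
    intro j
    -- By Fubini it suffices to fix the random vector; the bad `b` then form a proper subspace,
    -- which is Lebesgue null.
    rw [← Measure.ae_ae_comm (hm j)]
    filter_upwards [h0 j] with ω hω using key _ hω
  exact hall.exists

/-- The channel seen through the two transmit directions `b 0`, `b 1`. -/
def eff {M : ℕ} (b : Fin 2 → CVec M) (v : CVec M) (l : Fin 2) : ℂ := ∑ k, v k * b l k

lemma measurable_eff {M : ℕ} (b : Fin 2 → CVec M) (l : Fin 2) : Measurable fun v => eff b v l := by
  unfold eff
  fun_prop

lemma eff_sub {M : ℕ} (b : Fin 2 → CVec M) (v v' : CVec M) (l : Fin 2) :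
    eff b v l - eff b v' l = eff b (v - v') l := by
  simp [eff, sub_mul]

lemma norm_eff_le {M : ℕ} (b : Fin 2 → CVec M) (v : CVec M) (l : Fin 2) :
    ‖eff b v l‖ ≤ ‖v‖ * ∑ k, ‖b l k‖ := by
  rw [Finset.mul_sum]
  refine (norm_sum_le _ _).trans (Finset.sum_le_sum fun k _ => ?_)
  rw [norm_mul]
  exact mul_le_mul_of_nonneg_right (PiLp.norm_apply_le v k) (norm_nonneg _)

/-- Two fixed transmit directions through which the users' channels are almost surely linearly
independent, the first of which is almost surely not orthogonal to either channel. -/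
lemma FadingCSIT.exists_directions {M : ℕ} {Ω : Type*} [MeasurableSpace Ω] {μ : Measure Ω}
    [SFinite μ] (S : FadingCSIT M μ) : ∃ b : Fin 2 → CVec M, ∀ t,
      (∀ i, ∀ᵐ ω ∂μ, eff b (S.H i t ω) 0 ≠ 0) ∧
      ∀ᵐ ω ∂μ, eff b (S.H 0 t ω) 0 * eff b (S.H 1 t ω) 1 -
        eff b (S.H 0 t ω) 1 * eff b (S.H 1 t ω) 0 ≠ 0 := by
  obtain ⟨b₀, hb₀⟩ := exists_generic_vector (μ := μ) (fun p : Fin 2 × ℕ => S.H p.1 p.2)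
    (fun p => S.measurable_H p.1 p.2) (by
      rintro ⟨i, t⟩
      filter_upwards [S.linearIndependent_H t] with ω hω
      have := hω.ne_zero i
      fin_cases i <;> simpa using this)
  have hmeas : ∀ i t, Measurable fun ω => ∑ k, S.H i t ω k * b₀ k := fun i t =>
    (by fun_prop : Measurable fun v : CVec M => ∑ k, v k * b₀ k).comp (S.measurable_H i t)
  -- With `b₀` fixed, the determinant of the effective channels is a linear form in the second
  -- direction, with this random coefficient vector.
  obtain ⟨b₁, hb₁⟩ := exists_generic_vector (μ := μ) (fun (t : ℕ) ω =>
    (∑ k, S.H 0 t ω k * b₀ k) • S.H 1 t ω - (∑ k, S.H 1 t ω k * b₀ k) • S.H 0 t ω)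
    (fun t => ((hmeas 0 t).smul (S.measurable_H 1 t)).sub ((hmeas 1 t).smul (S.measurable_H 0 t)))
    (by
      intro t
      filter_upwards [S.linearIndependent_H t, hb₀ (0, t)] with ω hω h0 hcon
      rw [LinearIndependent.pair_iff] at hω
      refine h0 (hω (-(∑ k, S.H 1 t ω k * b₀ k)) (∑ k, S.H 0 t ω k * b₀ k) ?_).2
      rw [← hcon, neg_smul]
      abel)
  refine ⟨![b₀, b₁], fun t => ⟨fun i => ?_, ?_⟩⟩
  · simpa [eff] using hb₀ (i, t)
  · filter_upwards [hb₁ t] with ω hω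
    convert hω using 1
    simp only [eff, Matrix.cons_val_zero, Matrix.cons_val_one, PiLp.sub_apply, PiLp.smul_apply,
      smul_eq_mul, sub_mul, Finset.sum_sub_distrib, mul_assoc, ← Finset.mul_sum]
    ring

/-! ### Zero-forcing directions -/

/-- Two precoding directions for the effective channel estimate `f`: the first is annihilated by
`f`, and the change of basis is unimodular with entries bounded by one. -/
def prec (f : Fin 2 → ℂ) : Fin 2 → Fin 2 → ℂ :=
  if ‖f 1‖ ≤ ‖f 0‖ then ![![-(f 1 / f 0), 1], ![1, 0]] else ![![1, -(f 0 / f 1)], ![0, 1]]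

lemma prec_null (f : Fin 2 → ℂ) : f 0 * prec f 0 0 + f 1 * prec f 0 1 = 0 := by
  unfold prec
  split_ifs with h
  · by_cases h0 : f 0 = 0
    · have : f 1 = 0 := by simpa [h0] using h
      simp [h0, this]
    · simp
      field_simp
      ring
  · have h1 : f 1 ≠ 0 := by
      rintro h1
      apply h
      simp [h1]
    simp
    field_simp
    ring

lemma norm_prec_le (f : Fin 2 → ℂ) (s l : Fin 2) : ‖prec f s l‖ ≤ 1 := by
  unfold prec
  split_ifs with h
  · have : ‖f 1‖ / ‖f 0‖ ≤ 1 := div_le_one_of_le₀ h (norm_nonneg _)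
    fin_cases s <;> fin_cases l <;> simp [this]
  · have : ‖f 0‖ / ‖f 1‖ ≤ 1 := div_le_one_of_le₀ (not_le.1 h).le (norm_nonneg _)
    fin_cases s <;> fin_cases l <;> simp [this]

/-- One entry of each precoding matrix is `0` and two are `1`, so one coefficient is read off
directly and the other after subtracting a multiple of modulus at most that of the first. The bound
is uniform in `f`. -/
lemma norm_coeff_le_of_prec (f a : Fin 2 → ℂ) {ε : ℝ}
    (h : ∀ l, ‖∑ s, a s * prec f s l‖ ≤ ε) (s : Fin 2) : ‖a s‖ ≤ 2 * ε := by
  have h0 := h 0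
  have h1 := h 1
  have hε : 0 ≤ ε := (norm_nonneg _).trans h0
  have hn : ∀ l, ‖prec f 0 l‖ ≤ 1 := norm_prec_le f 0
  have n0 := hn 0
  have n1 := hn 1
  simp only [Fin.sum_univ_two] at h0 h1
  unfold prec at h0 h1 n0 n1
  split_ifs at h0 h1 n0 n1 with hf
  · simp at h0 h1 n0 n1
    have h2 : ‖a 1‖ ≤ ‖-(a 0 * (f 1 / f 0)) + a 1‖ + ‖a 0 * (f 1 / f 0)‖ := by
      simpa using norm_add_le (-(a 0 * (f 1 / f 0)) + a 1) (a 0 * (f 1 / f 0))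
    have h3 : ‖a 0 * (f 1 / f 0)‖ ≤ ε := by
      rw [norm_mul, norm_div]
      calc _ ≤ ‖a 0‖ * 1 := by gcongr
        _ ≤ ε := by linarith
    fin_cases s
    · simp; linarith
    · simp; linarith
  · simp at h0 h1 n0 n1
    have h2 : ‖a 1‖ ≤ ‖-(a 0 * (f 0 / f 1)) + a 1‖ + ‖a 0 * (f 0 / f 1)‖ := by
      simpa using norm_add_le (-(a 0 * (f 0 / f 1)) + a 1) (a 0 * (f 0 / f 1))
    have h3 : ‖a 0 * (f 0 / f 1)‖ ≤ ε := by
      rw [norm_mul, norm_div]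
      calc _ ≤ ‖a 0‖ * 1 := by gcongr
        _ ≤ ε := by linarith
    fin_cases s
    · simp; linarith
    · simp; linarith

lemma measurable_prec (s l : Fin 2) : Measurable fun f : Fin 2 → ℂ => prec f s l := by
  have hm : MeasurableSet {f : Fin 2 → ℂ | ‖f 1‖ ≤ ‖f 0‖} :=
    measurableSet_le (by fun_prop) (by fun_prop)
  have : (fun f : Fin 2 → ℂ => prec f s l) = fun f => if ‖f 1‖ ≤ ‖f 0‖ then
      (![![-(f 1 / f 0), 1], ![1, 0]] : Fin 2 → Fin 2 → ℂ) s l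
      else (![![1, -(f 0 / f 1)], ![0, 1]] : Fin 2 → Fin 2 → ℂ) s l := by
    ext f
    unfold prec
    split_ifs <;> rfl
  rw [this]
  refine Measurable.ite hm ?_ ?_
  · fin_cases s <;> fin_cases l <;> simp <;> fun_prop
  · fin_cases s <;> fin_cases l <;> simp <;> fun_prop

/-! ### Estimates within one slot -/

/-- The conditions on the effective channels `f`, their current estimates `fc` and their delayed
estimates `fd` in one time slot under which the scheme works. The symbols that interfere with user
`k` have amplitudes at most `A k` and `A' k`. -/
structure GoodSlot (B : ℝ) (A A' : Fin 2 → ℝ) (f fc fd : Fin 2 → Fin 2 → ℂ) : Prop where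
  norm_le : ∀ i l, ‖f i l‖ ≤ B
  one_le : ∀ i, 1 ≤ B * ‖f i 0‖
  one_le_det : 1 ≤ B * ‖f 0 0 * f 1 1 - f 0 1 * f 1 0‖
  current : ∀ i l, ‖f i l - fc i l‖ * A i ≤ B * A' i
  delayed : ∀ i l, ‖f i l - fd i l‖ * A i ≤ B

section Slot

variable {B : ℝ} {A A' : Fin 2 → ℝ} {f fc fd : Fin 2 → Fin 2 → ℂ}

lemma GoodSlot.one_le_det' (hg : GoodSlot B A A' f fc fd) (i : Fin 2) :
    1 ≤ B * ‖f i 0 * f (1 - i) 1 - f i 1 * f (1 - i) 0‖ := by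
  have h := hg.one_le_det
  revert i
  refine Fin.forall_fin_two.2 ⟨by simpa using h, ?_⟩
  have e : f 1 0 * f 0 1 - f 1 1 * f 0 0 = -(f 0 0 * f 1 1 - f 0 1 * f 1 0) := by ring
  rw [sub_self, e, norm_neg]
  exact h

lemma norm_signal_le (v a : Fin 2 → ℂ) {p q : ℝ} (ha : ‖a 0‖ ≤ p) (ha' : ‖a 1‖ ≤ q) (hpq : q ≤ p)
    (l : Fin 2) : ‖∑ s, a s * prec v s l‖ ≤ 2 * p := by
  rw [Fin.sum_univ_two]
  calc _ ≤ ‖a 0 * prec v 0 l‖ + ‖a 1 * prec v 1 l‖ := norm_add_le _ _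
    _ ≤ p * 1 + q * 1 := by
      rw [norm_mul, norm_mul]
      have := (norm_nonneg _).trans ha
      have := (norm_nonneg _).trans ha'
      gcongr <;> exact norm_prec_le _ _ _
    _ ≤ 2 * p := by linarith

lemma norm_dot_le (g X : Fin 2 → ℂ) {r : ℝ} (h : ∀ l, ‖g l‖ * ‖X l‖ ≤ r) :
    ‖∑ l, g l * X l‖ ≤ 2 * r := by
  rw [Fin.sum_univ_two]
  calc _ ≤ ‖g 0 * X 0‖ + ‖g 1 * X 1‖ := norm_add_le _ _
    _ ≤ r + r := by rw [norm_mul, norm_mul]; exact add_le_add (h 0) (h 1)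
    _ = 2 * r := by ring

/-- The strong symbol leaks only through the current estimation error, the weak one is small by
itself, and replacing the channel by its delayed estimate costs `O(B)`. This bounds the range of the
quantizer. -/
lemma GoodSlot.norm_delayed_interference_le (hg : GoodSlot B A A' f fc fd) (hB : 0 ≤ B)
    (k : Fin 2) (a : Fin 2 → ℂ) (ha : ‖a 0‖ ≤ A k) (ha' : ‖a 1‖ ≤ A' k) (hA : A' k ≤ A k)
    (hA' : 1 ≤ A' k) : ‖∑ l, fd k l * ∑ s, a s * prec (fc k) s l‖ ≤ 8 * B * A' k := by
  set X : Fin 2 → ℂ := fun l => ∑ s, a s * prec (fc k) s l with hX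
  have hXl : ∀ l, ‖X l‖ ≤ 2 * A k := norm_signal_le _ _ ha ha' hA
  have h1 : ‖∑ l, (fc k l - f k l) * (a 0 * prec (fc k) 0 l)‖ ≤ 2 * (B * A' k) := by
    refine norm_dot_le _ _ fun l => ?_
    rw [norm_sub_rev, norm_mul]
    calc _ ≤ ‖f k l - fc k l‖ * (A k * 1) := by
          have := (norm_nonneg _).trans ha
          gcongr
          exact norm_prec_le _ _ _
      _ ≤ B * A' k := by simpa using hg.current k l
  have h2 : ‖∑ l, f k l * (a 1 * prec (fc k) 1 l)‖ ≤ 2 * (B * A' k) := by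
    refine norm_dot_le _ _ fun l => ?_
    rw [norm_mul]
    calc _ ≤ B * (A' k * 1) := by
          have := (norm_nonneg _).trans ha'
          gcongr
          · exact hg.norm_le k l
          · exact norm_prec_le _ _ _
      _ = B * A' k := by ring
  have h3 : ‖∑ l, (f k l - fd k l) * X l‖ ≤ 2 * (2 * B) := by
    refine norm_dot_le _ _ fun l => ?_
    calc _ ≤ ‖f k l - fd k l‖ * (2 * A k) := by gcongr; exact hXl l
      _ = 2 * (‖f k l - fd k l‖ * A k) := by ring
      _ ≤ 2 * B := by linarith [hg.delayed k l]
  have hid : ∑ l, fd k l * X l = ∑ l, f k l * (a 1 * prec (fc k) 1 l)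
      - ∑ l, (fc k l - f k l) * (a 0 * prec (fc k) 0 l) - ∑ l, (f k l - fd k l) * X l := by
    simp only [hX, Fin.sum_univ_two]
    linear_combination a 0 * prec_null (fc k)
  rw [hid]
  calc _ ≤ 2 * (B * A' k) + 2 * (B * A' k) + 2 * (2 * B) :=
        (norm_sub_le _ _).trans (add_le_add ((norm_sub_le _ _).trans (add_le_add h2 h1)) h3)
    _ ≤ 8 * B * A' k := by nlinarith

/-- Applied to differences of two signals whose quantized delayed interference agrees: the delayed
estimate is accurate enough for the true interference to agree up to `O(B)` as well. -/
lemma GoodSlot.norm_interference_le (hg : GoodSlot B A A' f fc fd) (hB : 1 ≤ B) (k : Fin 2)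
    (Y : Fin 2 → ℂ) (hY : ∀ l, ‖Y l‖ ≤ 4 * A k) (hd : ‖∑ l, fd k l * Y l‖ ≤ 2) :
    ‖∑ l, f k l * Y l‖ ≤ 10 * B := by
  have h3 : ‖∑ l, (f k l - fd k l) * Y l‖ ≤ 2 * (4 * B) := by
    refine norm_dot_le _ _ fun l => ?_
    calc _ ≤ ‖f k l - fd k l‖ * (4 * A k) := by gcongr; exact hY l
      _ = 4 * (‖f k l - fd k l‖ * A k) := by ring
      _ ≤ 4 * B := by linarith [hg.delayed k l]
  have hid : ∑ l, f k l * Y l = ∑ l, fd k l * Y l + ∑ l, (f k l - fd k l) * Y l := by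
    simp only [Fin.sum_univ_two]
    ring
  rw [hid]
  refine (norm_add_le _ _).trans ?_
  linarith

/-- The common codeword is decoded with the user's own private signal, of amplitude of order `A (1 -
i)`, treated as noise; the interference `Z` is already controlled by backward decoding. -/
lemma GoodSlot.norm_common_le (hg : GoodSlot B A A' f fc fd) (hB : 1 ≤ B) (i : Fin 2)
    (c : ℂ) (Y Z : Fin 2 → ℂ) (hA : 1 ≤ A (1 - i)) (hY : ∀ l, ‖Y l‖ ≤ 4 * A (1 - i))
    (hZ : ‖∑ l, f i l * Z l‖ ≤ 10 * B)
    (hout : ‖f i 0 * c + ∑ l, f i l * Y l + ∑ l, f i l * Z l‖ ≤ 2 * B) :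
    ‖c‖ ≤ 20 * B ^ 2 * A (1 - i) := by
  have hB0 : 0 ≤ B := by linarith
  have h1 : ‖∑ l, f i l * Y l‖ ≤ 2 * (B * (4 * A (1 - i))) :=
    norm_dot_le _ _ fun l => by gcongr; exacts [hg.norm_le i l, hY l]
  have h2 : ‖f i 0 * c‖ ≤ 2 * B + 2 * (B * (4 * A (1 - i))) + 10 * B := by
    have : f i 0 * c = (f i 0 * c + ∑ l, f i l * Y l + ∑ l, f i l * Z l) - ∑ l, f i l * Y l
      - ∑ l, f i l * Z l := by ring
    rw [this]
    exact (norm_sub_le _ _).trans (add_le_add ((norm_sub_le _ _).trans (add_le_add hout h1)) hZ)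
  calc ‖c‖ = 1 * ‖c‖ := by ring
    _ ≤ (B * ‖f i 0‖) * ‖c‖ := by gcongr; exact hg.one_le i
    _ = B * ‖f i 0 * c‖ := by rw [norm_mul]; ring
    _ ≤ B * (2 * B + 2 * (B * (4 * A (1 - i))) + 10 * B) := by gcongr
    _ ≤ 20 * B ^ 2 * A (1 - i) := by nlinarith [mul_nonneg (mul_nonneg hB0 hB0) (sub_nonneg.2 hA)]

/-- The user's own output and its interference at the other user are two linear equations for `Y`.
Cramer's rule with determinant at least `1 / B` bounds `Y`, and inverting the precoder bounds the
symbols. -/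
lemma GoodSlot.norm_symbol_le (hg : GoodSlot B A A' f fc fd) (hB : 1 ≤ B) (i : Fin 2)
    (v a : Fin 2 → ℂ) (Y Z : Fin 2 → ℂ) (hY : ∀ l, Y l = ∑ s, a s * prec v s l)
    (hYk : ‖∑ l, f (1 - i) l * Y l‖ ≤ 10 * B)
    (hZ : ‖∑ l, f i l * Z l‖ ≤ 10 * B)
    (hout : ‖∑ l, f i l * Y l + ∑ l, f i l * Z l‖ ≤ 2 * B) (s : Fin 2) :
    ‖a s‖ ≤ 44 * B ^ 3 := by
  have hB0 : 0 ≤ B := by linarith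
  have hYi : ‖∑ l, f i l * Y l‖ ≤ 12 * B := by
    have : ∑ l, f i l * Y l = (∑ l, f i l * Y l + ∑ l, f i l * Z l) - ∑ l, f i l * Z l := by ring
    rw [this]
    exact (norm_sub_le _ _).trans (by linarith)
  set det := f i 0 * f (1 - i) 1 - f i 1 * f (1 - i) 0 with hdet
  have hcr : ∀ l : Fin 2, ‖det * Y l‖ ≤ 22 * B ^ 2 := by
    have e : ∀ p q : ℂ, ‖p‖ ≤ B → ‖q‖ ≤ B →
        ‖p * (∑ l, f i l * Y l) - q * ∑ l, f (1 - i) l * Y l‖ ≤ 22 * B ^ 2 := by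
      intro p q hp hq
      refine (norm_sub_le _ _).trans ?_
      rw [norm_mul, norm_mul]
      calc _ ≤ B * (12 * B) + B * (10 * B) := by gcongr
        _ = 22 * B ^ 2 := by ring
    refine Fin.forall_fin_two.2 ⟨?_, ?_⟩
    · convert e (f (1 - i) 1) (f i 1) (hg.norm_le _ _) (hg.norm_le _ _) using 2
      simp only [hdet, Fin.sum_univ_two]
      ring
    · have h1 : -(det * Y 1) =
          f (1 - i) 0 * (∑ l, f i l * Y l) - f i 0 * ∑ l, f (1 - i) l * Y l := by
        simp only [hdet, Fin.sum_univ_two]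
        ring
      rw [← norm_neg, h1]
      exact e _ _ (hg.norm_le _ _) (hg.norm_le _ _)
  have hYl : ∀ l, ‖∑ s, a s * prec v s l‖ ≤ 22 * B ^ 3 := by
    intro l
    rw [← hY]
    calc ‖Y l‖ = 1 * ‖Y l‖ := by ring
      _ ≤ (B * ‖det‖) * ‖Y l‖ := by gcongr; exact hg.one_le_det' i
      _ = B * ‖det * Y l‖ := by rw [norm_mul]; ring
      _ ≤ B * (22 * B ^ 2) := by gcongr; exact hcr l
      _ = 22 * B ^ 3 := by ring
  exact (norm_coeff_le_of_prec v a hYl s).trans (by linarith)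

end Slot

/-! ### Quantization of the interference -/

/-- Rounding of both coordinates, with values out of the range `[-R, R]` replaced by zero. -/
def quant (R : ℕ) (z : ℂ) : ℤ × ℤ :=
  if |⌊z.re⌋| ≤ R ∧ |⌊z.im⌋| ≤ R then (⌊z.re⌋, ⌊z.im⌋) else 0

lemma quant_mem (R : ℕ) (z : ℂ) :
    quant R z ∈ Finset.Icc (-(R : ℤ)) R ×ˢ Finset.Icc (-(R : ℤ)) R := by
  unfold quant
  split_ifs with h
  · simpa [abs_le] using h
  · simp

lemma measurable_quant (R : ℕ) : Measurable (quant R) := by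
  have h1 : Measurable fun z : ℂ => ⌊z.re⌋ := Int.measurable_floor.comp Complex.measurable_re
  have h2 : Measurable fun z : ℂ => ⌊z.im⌋ := Int.measurable_floor.comp Complex.measurable_im
  unfold quant
  refine Measurable.ite ?_ (h1.prodMk h2) measurable_const
  have : MeasurableSet {p : ℤ × ℤ | |p.1| ≤ R ∧ |p.2| ≤ R} := MeasurableSet.of_discrete
  exact (h1.prodMk h2) this

lemma quant_eq {R : ℕ} {z : ℂ} {r : ℝ} (hz : ‖z‖ ≤ r) (hR : r + 1 ≤ R) :
    quant R z = (⌊z.re⌋, ⌊z.im⌋) := by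
  have key : ∀ y : ℝ, |y| ≤ ‖z‖ → |⌊y⌋| ≤ (R : ℤ) := by
    intro y hy
    have hy' := abs_le.1 (hy.trans hz)
    have h1 := Int.floor_le y
    have h2 := Int.lt_floor_add_one y
    have : (|(⌊y⌋ : ℝ)| : ℝ) ≤ R := abs_le.2 ⟨by linarith, by linarith⟩
    exact_mod_cast this
  exact if_pos ⟨key _ (Complex.abs_re_le_norm z), key _ (Complex.abs_im_le_norm z)⟩

lemma norm_sub_le_of_quant_eq {R : ℕ} {z z' : ℂ} {r : ℝ} (hz : ‖z‖ ≤ r) (hz' : ‖z'‖ ≤ r)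
    (hR : r + 1 ≤ R) (h : quant R z = quant R z') : ‖z - z'‖ ≤ 2 := by
  rw [quant_eq hz hR, quant_eq hz' hR, Prod.mk.injEq] at h
  have h1 := Int.abs_sub_lt_one_of_floor_eq_floor h.1
  have h2 := Int.abs_sub_lt_one_of_floor_eq_floor h.2
  refine (Complex.norm_le_abs_re_add_abs_im _).trans ?_
  simp only [Complex.sub_re, Complex.sub_im]
  linarith

/-! ### The block-Markov scheme and backward decoding -/

/-- The data carried by a pair of messages: `com i s` is the part of user `i`'s message that is sent
as common information in block `s`, and `sym i t` are the two private symbols for user `i` in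
slot `t`. -/
structure Payload where
  com : Fin 2 → ℕ → ℕ
  sym : Fin 2 → ℕ → Fin 2 → ℂ

/-- A block-Markov scheme: blocks consist of `T` active slots followed by `η` idle ones. -/
structure Scheme (M : ℕ) where
  /-- transmit directions -/
  b : Fin 2 → CVec M
  T : ℕ
  η : ℕ
  /-- range of the quantizer for the interference at each user and slot -/
  R : Fin 2 → ℕ → ℕ
  /-- the common codebook of each block, indexed by common messages and quantized interference -/
  cb : ℕ → (Fin 2 → ℕ) × (Fin 2 → Fin T → ℤ × ℤ) → Fin T → ℂ

namespace Scheme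

variable {M : ℕ} (𝒮 : Scheme M) (E : Fin 2 → ℕ → ℕ → CVec M) (m m' : Payload)

/-- The block period. -/
def L : ℕ := 𝒮.T + 𝒮.η

/-- The signal (in the coordinates of the transmit directions) that carries user `i`'s private
symbols in slot `t`. -/
def signal (i : Fin 2) (t : ℕ) (l : Fin 2) : ℂ :=
  ∑ s, m.sym i t s * prec (eff 𝒮.b (E (1 - i) t t)) s l

/-- The interference at user `k` in slot `t`, computed from the delayed estimate. -/
def interference (k : Fin 2) (t : ℕ) : ℂ :=
  ∑ l, eff 𝒮.b (E k t (t + 𝒮.η)) l * 𝒮.signal E m (1 - k) t l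

/-- The codebook index sent in a block: the common messages of this block and the quantized
interference of the previous block. -/
def index (s : ℕ) : (Fin 2 → ℕ) × (Fin 2 → Fin 𝒮.T → ℤ × ℤ) :=
  (fun i => m.com i s, fun k j => if s = 0 then 0 else
    quant (𝒮.R k ((s - 1) * 𝒮.L + j)) (𝒮.interference E m k ((s - 1) * 𝒮.L + j)))

/-- The transmitted vector in slot `t`. -/
def input (t : ℕ) : CVec M :=
  if h : t % 𝒮.L < 𝒮.T then
    (𝒮.cb (t / 𝒮.L) (𝒮.index E m (t / 𝒮.L)) ⟨t % 𝒮.L, h⟩ + ∑ i, 𝒮.signal E m i t 0) • 𝒮.b 0 +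
      (∑ i, 𝒮.signal E m i t 1) • 𝒮.b 1
  else 0

/-- The indices that can occur in block `s` if there are `K i` common messages of user `i`. -/
def indices (K : Fin 2 → ℕ) (s : ℕ) : Finset ((Fin 2 → ℕ) × (Fin 2 → Fin 𝒮.T → ℤ × ℤ)) :=
  (Fintype.piFinset fun i => Finset.range (K i)) ×ˢ
    Fintype.piFinset fun k => Fintype.piFinset fun j : Fin 𝒮.T =>
      Finset.Icc (-(𝒮.R k ((s - 1) * 𝒮.L + j) : ℤ)) (𝒮.R k ((s - 1) * 𝒮.L + j)) ×ˢ
        Finset.Icc (-(𝒮.R k ((s - 1) * 𝒮.L + j) : ℤ)) (𝒮.R k ((s - 1) * 𝒮.L + j))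

variable {𝒮 E m m'}

/-- Clipping in `quant` makes this hold for every array of estimates, not only on good states. -/
lemma index_mem {K : Fin 2 → ℕ} {s : ℕ} (h : ∀ i, m.com i s < K i) :
    𝒮.index E m s ∈ 𝒮.indices K s := by
  simp only [indices, index, Finset.mem_product, Fintype.mem_piFinset]
  refine ⟨fun i => by simpa using h i, fun k j => ?_⟩
  split_ifs with hs
  · simp
  · simpa using quant_mem (𝒮.R k ((s - 1) * 𝒮.L + j)) _

lemma slot_div_mod {s j : ℕ} (hj : j < 𝒮.T) :
    (s * 𝒮.L + j) / 𝒮.L = s ∧ (s * 𝒮.L + j) % 𝒮.L = j := by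
  have hL : j < 𝒮.L := hj.trans_le (Nat.le_add_right _ _)
  constructor
  · rw [mul_comm, Nat.mul_add_div (by omega), Nat.div_eq_of_lt hL, add_zero]
  · rw [mul_comm, Nat.mul_add_mod, Nat.mod_eq_of_lt hL]

lemma input_slot (s : ℕ) (j : Fin 𝒮.T) : 𝒮.input E m (s * 𝒮.L + j) =
    (𝒮.cb s (𝒮.index E m s) j + ∑ i, 𝒮.signal E m i (s * 𝒮.L + j) 0) • 𝒮.b 0 +
      (∑ i, 𝒮.signal E m i (s * 𝒮.L + j) 1) • 𝒮.b 1 := by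
  obtain ⟨h1, h2⟩ := slot_div_mod (𝒮 := 𝒮) (s := s) j.2
  have h : (s * 𝒮.L + j) % 𝒮.L < 𝒮.T := by rw [h2]; exact j.2
  unfold input
  rw [dif_pos h]
  simp only [h1, h2]

lemma received_slot (v : CVec M) (s : ℕ) (j : Fin 𝒮.T) (i : Fin 2) :
    ∑ k, v k * 𝒮.input E m (s * 𝒮.L + j) k = eff 𝒮.b v 0 * 𝒮.cb s (𝒮.index E m s) j +
      ∑ l, eff 𝒮.b v l * 𝒮.signal E m i (s * 𝒮.L + j) l +
      ∑ l, eff 𝒮.b v l * 𝒮.signal E m (1 - i) (s * 𝒮.L + j) l := by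
  have hsum : ∀ x : Fin 2 → ℂ, ∑ i', x i' = x i + x (1 - i) := by
    intro x
    revert i
    refine Fin.forall_fin_two.2 ⟨by simp [Fin.sum_univ_two], ?_⟩
    rw [Fin.sum_univ_two, sub_self, add_comm]
  rw [input_slot, hsum, hsum]
  simp only [Fin.sum_univ_two, eff, PiLp.add_apply, PiLp.smul_apply, smul_eq_mul,
    Finset.sum_mul, ← Finset.sum_add_distrib]
  refine Finset.sum_congr rfl fun k _ => ?_
  ring

/-- On good channel states, backward decoding recovers the payload of user `i` from any noiseless
output that is known up to `2 * B`. -/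
theorem payload_eq_of_output_close {B : ℝ} (hB : 1 ≤ B) {A A' : Fin 2 → ℕ → ℝ}
    (hA : ∀ k t, A' k t ≤ A k t) (hA' : ∀ k t, 1 ≤ A' k t)
    (hR : ∀ k t, 8 * B * A' k t + 1 ≤ 𝒮.R k t) {h : Fin 2 → ℕ → CVec M} {S : ℕ}
    (hgood : ∀ s ≤ S, ∀ j < 𝒮.T, GoodSlot B (fun k => A k (s * 𝒮.L + j))
      (fun k => A' k (s * 𝒮.L + j)) (fun k => eff 𝒮.b (h k (s * 𝒮.L + j)))
      (fun k => eff 𝒮.b (E k (s * 𝒮.L + j) (s * 𝒮.L + j)))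
      (fun k => eff 𝒮.b (E k (s * 𝒮.L + j) (s * 𝒮.L + j + 𝒮.η))))
    (hm : ∀ i t, ‖m.sym i t 0‖ ≤ A (1 - i) t ∧ ‖m.sym i t 1‖ ≤ A' (1 - i) t)
    (hm' : ∀ i t, ‖m'.sym i t 0‖ ≤ A (1 - i) t ∧ ‖m'.sym i t 1‖ ≤ A' (1 - i) t)
    (hlast : ∀ i, ∀ j < 𝒮.T, m.sym i (S * 𝒮.L + j) = 0 ∧ m'.sym i (S * 𝒮.L + j) = 0)
    (hsep : ∀ i t l, ‖m.sym i t l - m'.sym i t l‖ ≤ 44 * B ^ 3 → m.sym i t l = m'.sym i t l)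
    (i : Fin 2)
    (hcb : ∀ s ≤ S, (∀ j, ‖𝒮.cb s (𝒮.index E m s) j - 𝒮.cb s (𝒮.index E m' s) j‖ ≤
      20 * B ^ 2 * A (1 - i) (s * 𝒮.L + j)) → 𝒮.index E m s = 𝒮.index E m' s)
    (hout : ∀ s ≤ S, ∀ j < 𝒮.T,
      ‖∑ k, h i (s * 𝒮.L + j) k * 𝒮.input E m (s * 𝒮.L + j) k -
        ∑ k, h i (s * 𝒮.L + j) k * 𝒮.input E m' (s * 𝒮.L + j) k‖ ≤ 2 * B) :
    ∀ s ≤ S, m.com i s = m'.com i s ∧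
      ∀ j < 𝒮.T, m.sym i (s * 𝒮.L + j) = m'.sym i (s * 𝒮.L + j) := by
  have hsig : ∀ m : Payload, (∀ i t, ‖m.sym i t 0‖ ≤ A (1 - i) t ∧ ‖m.sym i t 1‖ ≤ A' (1 - i) t) →
      ∀ i t l, ‖𝒮.signal E m i t l‖ ≤ 2 * A (1 - i) t := fun m hm i t l =>
    norm_signal_le _ _ (hm i t).1 (hm i t).2 (hA _ _) l
  have hrev : ∀ k : Fin 2, 1 - (1 - k) = k := fun k => by simp
  have hbound : ∀ m : Payload,
      (∀ i t, ‖m.sym i t 0‖ ≤ A (1 - i) t ∧ ‖m.sym i t 1‖ ≤ A' (1 - i) t) →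
      ∀ s ≤ S, ∀ j < 𝒮.T, ∀ k, ‖𝒮.interference E m k (s * 𝒮.L + j)‖ ≤
        8 * B * A' k (s * 𝒮.L + j) := by
    intro m hm s hs j hj k
    have h1 := hm (1 - k) (s * 𝒮.L + j)
    rw [hrev] at h1
    have := (hgood s hs j hj).norm_delayed_interference_le (by linarith) k
      (m.sym (1 - k) (s * 𝒮.L + j)) h1.1 h1.2 (hA _ _) (hA' _ _)
    simpa only [interference, signal, hrev] using this
  have hdelta : ∀ i t l, ‖𝒮.signal E m i t l - 𝒮.signal E m' i t l‖ ≤ 4 * A (1 - i) t :=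
    fun i t l => (norm_sub_le _ _).trans (by linarith [hsig m hm i t l, hsig m' hm' i t l])
  -- Decoding of one block, once the interference in it is known up to rounding at both receivers:
  -- the common index first, then the private symbols.
  have hblock : ∀ s ≤ S, (∀ j < 𝒮.T, ∀ k, ‖𝒮.interference E m k (s * 𝒮.L + j) -
      𝒮.interference E m' k (s * 𝒮.L + j)‖ ≤ 2) → 𝒮.index E m s = 𝒮.index E m' s ∧
      ∀ j < 𝒮.T, m.sym i (s * 𝒮.L + j) = m'.sym i (s * 𝒮.L + j) := by
    intro s hs hint
    have htrue : ∀ j < 𝒮.T, ∀ k, ‖∑ l, eff 𝒮.b (h k (s * 𝒮.L + j)) l *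
        (𝒮.signal E m (1 - k) (s * 𝒮.L + j) l - 𝒮.signal E m' (1 - k) (s * 𝒮.L + j) l)‖ ≤
        10 * B := by
      intro j hj k
      refine (hgood s hs j hj).norm_interference_le hB k _ (fun l => ?_) ?_
      · simpa only [hrev] using hdelta (1 - k) (s * 𝒮.L + j) l
      · simpa only [interference, mul_sub, Finset.sum_sub_distrib] using hint j hj k
    have hidx : 𝒮.index E m s = 𝒮.index E m' s := by
      refine hcb s hs fun j => ?_
      refine (hgood s hs j j.2).norm_common_le hB i _
        (fun l => 𝒮.signal E m i (s * 𝒮.L + j) l - 𝒮.signal E m' i (s * 𝒮.L + j) l) _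
        ((hA' _ _).trans (hA _ _)) (fun l => hdelta i _ l) (htrue j j.2 i) ?_
      have := hout s hs j j.2
      rw [received_slot _ s j i, received_slot _ s j i] at this
      refine le_of_eq_of_le (congrArg norm ?_) this
      simp only [Fin.sum_univ_two]
      ring
    refine ⟨hidx, fun j hj => funext fun l => hsep _ _ _ ?_⟩
    refine (hgood s hs j hj).norm_symbol_le hB i (eff 𝒮.b (E (1 - i) (s * 𝒮.L + j) (s * 𝒮.L + j)))
      (fun l => m.sym i (s * 𝒮.L + j) l - m'.sym i (s * 𝒮.L + j) l)
      (fun l => 𝒮.signal E m i (s * 𝒮.L + j) l - 𝒮.signal E m' i (s * 𝒮.L + j) l) _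
      (fun l => ?_) ?_ (htrue j hj i) ?_ l
    · simp only [signal, sub_mul, Finset.sum_sub_distrib]
    · simpa only [hrev] using htrue j hj (1 - i)
    · have := hout s hs j hj
      rw [received_slot _ s ⟨j, hj⟩ i, received_slot _ s ⟨j, hj⟩ i, hidx] at this
      refine le_of_eq_of_le (congrArg norm ?_) this
      simp only [Fin.sum_univ_two]
      ring
  -- Backward induction over blocks. The last block has no private symbols; the index of block `S -
  -- d` contains the quantized interference of block `S - (d + 1)`.
  have hint : ∀ d ≤ S, ∀ j < 𝒮.T, ∀ k, ‖𝒮.interference E m k ((S - d) * 𝒮.L + j) -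
      𝒮.interference E m' k ((S - d) * 𝒮.L + j)‖ ≤ 2 := by
    intro d
    induction d with
    | zero =>
      intro _ j hj k
      have := hlast (1 - k) j hj
      simp [interference, signal, this.1, this.2]
    | succ d ih =>
      intro hd j hj k
      have hidx := (hblock (S - d) (Nat.sub_le _ _) (ih (by omega))).1
      have h1 := congrFun (congrFun (congrArg Prod.snd hidx) k) ⟨j, hj⟩
      simp only [index, show S - d ≠ 0 by omega, if_false] at h1
      rw [show S - d - 1 = S - (d + 1) by omega] at h1
      exact norm_sub_le_of_quant_eq (hbound m hm _ (Nat.sub_le _ _) j hj k)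
        (hbound m' hm' _ (Nat.sub_le _ _) j hj k) (hR _ _) h1
  intro s hs
  have hs' : S - (S - s) = s := by omega
  have := hblock s hs (by simpa only [hs'] using hint (S - s) (Nat.sub_le _ _))
  exact ⟨congrFun (congrArg Prod.fst this.1) i, this.2⟩

lemma measurable_signal (m : Payload) (i : Fin 2) (t : ℕ) (l : Fin 2) :
    Measurable fun E => 𝒮.signal E m i t l := by
  unfold signal
  refine Finset.measurable_sum _ fun s _ => Measurable.const_mul ?_ _
  refine (measurable_prec s l).comp (measurable_pi_iff.2 fun l' => (measurable_eff _ l').comp ?_)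
  fun_prop

lemma measurable_input (m : Payload) (t : ℕ) : Measurable fun E => 𝒮.input E m t := by
  unfold input
  split_ifs with h
  · have hidx : Measurable fun E => 𝒮.index E m (t / 𝒮.L) := by
      unfold index
      refine measurable_const.prodMk (measurable_pi_iff.2 fun k => measurable_pi_iff.2 fun j => ?_)
      split_ifs
      · exact measurable_const
      · refine (measurable_quant _).comp ?_
        unfold interference
        refine Finset.measurable_sum _ fun l _ => Measurable.mul ((measurable_eff _ l).comp ?_)
          (measurable_signal _ _ _ _)
        fun_prop
    have hcb : Measurable fun E => 𝒮.cb (t / 𝒮.L) (𝒮.index E m (t / 𝒮.L)) ⟨t % 𝒮.L, h⟩ :=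
      (Measurable.of_discrete (f := fun x => 𝒮.cb (t / 𝒮.L) x ⟨t % 𝒮.L, h⟩)).comp hidx
    refine Measurable.add (Measurable.smul_const (hcb.add ?_) _) (Measurable.smul_const ?_ _)
    · exact Finset.measurable_sum _ fun i _ => measurable_signal _ _ _ _
    · exact Finset.measurable_sum _ fun i _ => measurable_signal _ _ _ _
  · exact measurable_const

lemma input_causal (m : Payload) (t : ℕ) (E E' : Fin 2 → ℕ → ℕ → CVec M)
    (h : ∀ j τ t', τ ≤ t → t' ≤ t → E j τ t' = E' j τ t') : 𝒮.input E m t = 𝒮.input E' m t := by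
  have hsig : ∀ i τ, τ ≤ t → 𝒮.signal E m i τ = 𝒮.signal E' m i τ := by
    intro i τ hτ
    ext l
    simp only [signal, h _ _ _ hτ hτ]
  unfold input
  split_ifs with ht
  · have hidx : 𝒮.index E m (t / 𝒮.L) = 𝒮.index E' m (t / 𝒮.L) := by
      unfold index
      congr 1
      ext1 k
      ext1 j
      split_ifs with h0
      · rfl
      -- The `η` idle slots ensure that all delayed estimates of a block have arrived when the next
      -- one starts.
      · have hle : (t / 𝒮.L - 1) * 𝒮.L + j + 𝒮.η ≤ t := by
          obtain ⟨q, hq⟩ := Nat.exists_eq_succ_of_ne_zero h0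
          have h1 := Nat.div_mul_le_self t 𝒮.L
          have h2 := j.2
          have h3 : 𝒮.L = 𝒮.T + 𝒮.η := rfl
          rw [hq, Nat.succ_mul] at h1
          rw [hq, Nat.succ_sub_one]
          omega
        simp only [interference]
        rw [hsig _ _ (by omega), h k ((t / 𝒮.L - 1) * 𝒮.L + j) _ (by omega) hle]
    rw [hidx]
    simp only [hsig _ t le_rfl]
  · rfl

/-- An amplitude bound for the transmitted vector. -/
lemma norm_input_le {p : ℝ} (hp : 0 ≤ p) (hcb : ∀ s x j, ‖𝒮.cb s x j‖ ≤ p)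
    (hm : ∀ i t l, ‖m.sym i t l‖ ≤ p) (t : ℕ) :
    ‖𝒮.input E m t‖ ≤ 5 * p * (‖𝒮.b 0‖ + ‖𝒮.b 1‖) := by
  have hsig : ∀ i l, ‖𝒮.signal E m i t l‖ ≤ 2 * p := fun i l =>
    norm_signal_le _ _ (hm i t 0) (hm i t 1) le_rfl l
  have hsum : ∀ l, ‖∑ i, 𝒮.signal E m i t l‖ ≤ 4 * p := fun l => by
    rw [Fin.sum_univ_two]
    exact (norm_add_le _ _).trans (by linarith [hsig 0 l, hsig 1 l])
  unfold input
  split_ifs with h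
  · refine (norm_add_le _ _).trans ?_
    rw [norm_smul, norm_smul, mul_add]
    refine add_le_add ?_ ?_
    · gcongr
      have := hcb (t / 𝒮.L) (𝒮.index E m (t / 𝒮.L)) ⟨t % 𝒮.L, h⟩
      exact (norm_add_le _ _).trans (by linarith [hsum 0])
    · gcongr
      linarith [hsum 1]
  · rw [norm_zero]
    positivity

end Scheme

/-! ### Packing: constellations and common codebooks -/

/-- The Gilbert–Varshamov bound for an arbitrary confusability relation. -/
lemma exists_large_independent {α : Type*} (X : Finset α) (r : α → α → Prop)
    (hrefl : ∀ x, r x x) (hsymm : ∀ x y, r x y → r y x) {V : ℝ}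
    (hV : ∀ x ∈ X, ∃ N : Finset α, (∀ y ∈ X, r x y → y ∈ N) ∧ (N.card : ℝ) ≤ V) :
    ∃ C ⊆ X, (∀ x ∈ C, ∀ y ∈ C, r x y → x = y) ∧ (X.card : ℝ) ≤ C.card * V := by
  classical
  obtain ⟨C, hC, hmax⟩ := Finset.exists_max_image
    (X.powerset.filter fun C => ∀ x ∈ C, ∀ y ∈ C, r x y → x = y) Finset.card ⟨∅, by simp⟩
  simp only [Finset.mem_filter, Finset.mem_powerset] at hC hmax
  refine ⟨C, hC.1, hC.2, ?_⟩
  choose! N hN hNV using hV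
  -- Maximality: a point outside all neighbourhoods could be added to `C`.
  have hcover : X ⊆ C.biUnion N := by
    intro y hy
    by_contra hcon
    simp only [Finset.mem_biUnion, not_exists, not_and] at hcon
    have hno : ∀ x ∈ C, ¬ r x y := fun x hx h => hcon x hx (hN x (hC.1 hx) y hy h)
    have hyC : y ∉ C := fun h => hno y h (hrefl y)
    have := hmax (insert y C) ⟨Finset.insert_subset hy hC.1, by
      intro a ha b hb hab
      rcases Finset.mem_insert.1 ha with ha | ha <;> rcases Finset.mem_insert.1 hb with hb | hb
      · rw [ha, hb]
      · exact (hno b hb (hsymm _ _ (ha ▸ hab))).elim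
      · exact (hno a ha (hb ▸ hab)).elim
      · exact hC.2 a ha b hb hab⟩
    rw [Finset.card_insert_of_notMem hyC] at this
    omega
  calc (X.card : ℝ) ≤ ((C.biUnion N).card : ℝ) := by exact_mod_cast Finset.card_le_card hcover
    _ ≤ ∑ x ∈ C, ((N x).card : ℝ) := by exact_mod_cast Finset.card_biUnion_le
    _ ≤ ∑ _x ∈ C, V := Finset.sum_le_sum fun x hx => hNV x (hC.1 hx)
    _ = C.card * V := by simp

/-- The Gaussian integer with the given coordinates. -/
def gaussInt (p : ℤ × ℤ) : ℂ := ⟨p.1, p.2⟩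

lemma gaussInt_injective : Function.Injective gaussInt := by
  rintro ⟨a, b⟩ ⟨a', b'⟩ h
  simpa [gaussInt, Complex.ext_iff] using h

lemma abs_sub_le_norm_gaussInt (p q : ℤ × ℤ) :
    (|p.1 - q.1| : ℤ) ≤ ‖gaussInt p - gaussInt q‖ ∧ (|p.2 - q.2| : ℤ) ≤ ‖gaussInt p - gaussInt q‖ :=
  ⟨by simpa [gaussInt] using Complex.abs_re_le_norm (gaussInt p - gaussInt q),
    by simpa [gaussInt] using Complex.abs_im_le_norm (gaussInt p - gaussInt q)⟩

/-- A square of Gaussian integers. -/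
def grid (R : ℝ) : Finset (ℤ × ℤ) :=
  Finset.Ico (0 : ℤ) ⌈R⌉₊ ×ˢ Finset.Ico (0 : ℤ) ⌈R⌉₊

lemma card_grid_ge {R : ℝ} (hR : 0 ≤ R) : R ^ 2 ≤ (grid R).card := by
  have := Nat.le_ceil R
  simp only [grid, Finset.card_product, Int.card_Ico, sub_zero, Int.toNat_natCast, Nat.cast_mul]
  nlinarith

lemma norm_gaussInt_le {R : ℝ} {p : ℤ × ℤ} (hp : p ∈ grid R) :
    ‖gaussInt p‖ ≤ 2 * R := by
  have key : ∀ a : ℤ, 0 ≤ a → a < ⌈R⌉₊ → |(a : ℝ)| ≤ R := by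
    intro a h0 h1
    rw [abs_of_nonneg (by exact_mod_cast h0)]
    lift a to ℕ using h0
    have : a < ⌈R⌉₊ := by exact_mod_cast h1
    simpa using (Nat.lt_ceil.1 this).le
  simp only [grid, Finset.mem_product, Finset.mem_Ico] at hp
  refine (Complex.norm_le_abs_re_add_abs_im _).trans ?_
  have h1 := key _ hp.1.1 hp.1.2
  have h2 := key _ hp.2.1 hp.2.2
  simp only [gaussInt]
  linarith

/-- A square constellation with minimum distance `D`. -/
lemma exists_constellation {D R : ℝ} (hD : 0 < D) (hR : 0 < R) : ∃ A : Finset ℂ, 0 ∈ A ∧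
    R ^ 2 ≤ A.card ∧ (∀ a ∈ A, ‖a‖ ≤ 2 * R * D) ∧
    ∀ a ∈ A, ∀ a' ∈ A, ‖a - a'‖ < D → a = a' := by
  classical
  have hDc : (D : ℂ) ≠ 0 := by exact_mod_cast hD.ne'
  have hinj : Function.Injective fun p => (D : ℂ) * gaussInt p := fun p q h =>
    gaussInt_injective (mul_left_cancel₀ hDc h)
  refine ⟨(grid R).image fun p => (D : ℂ) * gaussInt p, ?_, ?_, ?_, ?_⟩
  · refine Finset.mem_image.2 ⟨0, ?_, ?_⟩
    · simp [grid, hR]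
    · simp [gaussInt, Complex.ext_iff]
  · rw [Finset.card_image_of_injective _ hinj]
    exact card_grid_ge hR.le
  · intro a ha
    obtain ⟨p, hp, rfl⟩ := Finset.mem_image.1 ha
    rw [norm_mul, Complex.norm_real, Real.norm_of_nonneg hD.le, mul_comm]
    exact mul_le_mul_of_nonneg_right (norm_gaussInt_le hp) hD.le
  · intro a ha a' ha' h
    obtain ⟨p, -, rfl⟩ := Finset.mem_image.1 ha
    obtain ⟨q, -, rfl⟩ := Finset.mem_image.1 ha'
    rw [← mul_sub, norm_mul, Complex.norm_real, Real.norm_of_nonneg hD.le,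
      mul_lt_iff_lt_one_right hD] at h
    obtain ⟨h1, h2⟩ := abs_sub_le_norm_gaussInt p q
    have e1 : |p.1 - q.1| < 1 := by exact_mod_cast h1.trans_lt h
    have e2 : |p.2 - q.2| < 1 := by exact_mod_cast h2.trans_lt h
    rw [Int.abs_lt_one_iff] at e1 e2
    rw [show p = q from Prod.ext (by omega) (by omega)]

/-- A codebook over `T` slots with entries of amplitude at most `2 * R` that is separated with
respect to two different noise profiles. -/
lemma exists_codebook {T : ℕ} {R : ℝ} (hR : 0 ≤ R) (ρ : Fin 2 → Fin T → ℝ) (hρ : ∀ i j, 0 ≤ ρ i j) :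
    ∃ C : Finset (Fin T → ℂ), (∀ c ∈ C, ∀ j, ‖c j‖ ≤ 2 * R) ∧
      (∀ i, ∀ c ∈ C, ∀ c' ∈ C, (∀ j, ‖c j - c' j‖ ≤ ρ i j) → c = c') ∧
      (R ^ 2) ^ T ≤ C.card * ∑ i, ∏ j, (2 * ρ i j + 1) ^ 2 := by
  classical
  let g : (Fin T → ℤ × ℤ) → Fin T → ℂ := fun x j => gaussInt (x j)
  have hg : Function.Injective g := fun x y h =>
    funext fun j => gaussInt_injective (congrFun h j)
  let X : Finset (Fin T → ℤ × ℤ) := Fintype.piFinset fun _ => grid R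
  obtain ⟨C, hCX, hC, hcard⟩ := exists_large_independent X
    (fun x y => ∃ i, ∀ j, ‖g x j - g y j‖ ≤ ρ i j)
    (V := ∑ i, ∏ j, (2 * ρ i j + 1) ^ 2) (fun x => ⟨0, fun j => by simpa using hρ 0 j⟩)
    (fun x y ⟨i, h⟩ => ⟨i, fun j => by rw [norm_sub_rev]; exact h j⟩) (by
      intro x _
      -- The words that user `i` may confuse with `x` lie in a product of boxes of side `2⌊ρ⌋ + 1`.
      -- The union over both users gives one codebook that serves both profiles, at the cost of a
      -- sum.
      let N : Fin 2 → Finset (Fin T → ℤ × ℤ) := fun i => Fintype.piFinset fun j =>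
        Finset.Icc ((x j).1 - ⌊ρ i j⌋₊) ((x j).1 + ⌊ρ i j⌋₊) ×ˢ
          Finset.Icc ((x j).2 - ⌊ρ i j⌋₊) ((x j).2 + ⌊ρ i j⌋₊)
      refine ⟨Finset.univ.biUnion N, ?_, ?_⟩
      · rintro y - ⟨i, hi⟩
        refine Finset.mem_biUnion.2 ⟨i, Finset.mem_univ _, Fintype.mem_piFinset.2 fun j => ?_⟩
        obtain ⟨h1, h2⟩ := abs_sub_le_norm_gaussInt (x j) (y j)
        have key : ∀ a : ℤ, (|a| : ℤ) ≤ ‖gaussInt (x j) - gaussInt (y j)‖ →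
            |a| ≤ (⌊ρ i j⌋₊ : ℤ) := by
          intro a ha
          have h3 : ((a.natAbs : ℕ) : ℝ) ≤ ρ i j := by
            have := ha.trans (hi j)
            rwa [Int.abs_eq_natAbs, Int.cast_natCast] at this
          rw [Int.abs_eq_natAbs]
          exact_mod_cast Nat.le_floor h3
        have e1 := abs_le.1 (key _ h1)
        have e2 := abs_le.1 (key _ h2)
        simp only [Finset.mem_product, Finset.mem_Icc]
        omega
      · calc ((Finset.univ.biUnion N).card : ℝ) ≤ ∑ i, ((N i).card : ℝ) := by
              exact_mod_cast Finset.card_biUnion_le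
          _ ≤ _ := by
            refine Finset.sum_le_sum fun i _ => ?_
            simp only [N, Fintype.card_piFinset, Finset.card_product, Int.card_Icc, Nat.cast_prod]
            refine Finset.prod_le_prod (fun _ _ => by positivity) fun j _ => ?_
            have h1 : ∀ a : ℤ, ((a + ⌊ρ i j⌋₊ + 1 - (a - ⌊ρ i j⌋₊)).toNat : ℝ) ≤
                2 * ρ i j + 1 := by
              intro a
              rw [show a + ⌊ρ i j⌋₊ + 1 - (a - ⌊ρ i j⌋₊) = ((2 * ⌊ρ i j⌋₊ + 1 : ℕ) : ℤ) by
                push_cast; ring, Int.toNat_natCast]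
              push_cast
              linarith [Nat.floor_le (hρ i j)]
            push_cast
            rw [pow_two]
            exact mul_le_mul (h1 _) (h1 _) (by positivity) (by linarith [hρ i j]))
  refine ⟨C.image g, ?_, ?_, ?_⟩
  · intro c hc j
    obtain ⟨x, hx, rfl⟩ := Finset.mem_image.1 hc
    exact norm_gaussInt_le (Fintype.mem_piFinset.1 (hCX hx) j)
  · intro i c hc c' hc' h
    obtain ⟨x, hx, rfl⟩ := Finset.mem_image.1 hc
    obtain ⟨y, hy, rfl⟩ := Finset.mem_image.1 hc'
    rw [hC x hx y hy ⟨i, h⟩]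
  · rw [Finset.card_image_of_injective _ hg]
    refine le_trans ?_ hcard
    simp only [X, Fintype.card_piFinset_const, Nat.cast_pow]
    exact pow_le_pow_left₀ (by positivity) (card_grid_ge hR) T

/-- A labelling of a finite set by codewords of a separated codebook, extended by zero. -/
lemma exists_encoding {α : Type*} {T : ℕ} {R : ℝ} (hR : 0 ≤ R) (ρ : Fin 2 → Fin T → ℝ)
    (hρ : ∀ i j, 0 ≤ ρ i j) (I : Finset α)
    (hI : (I.card : ℝ) * ∑ i, ∏ j, (2 * ρ i j + 1) ^ 2 ≤ (R ^ 2) ^ T) :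
    ∃ cb : α → Fin T → ℂ, (∀ x j, ‖cb x j‖ ≤ 2 * R) ∧
      ∀ i, ∀ x ∈ I, ∀ y ∈ I, (∀ j, ‖cb x j - cb y j‖ ≤ ρ i j) → x = y := by
  classical
  obtain ⟨C, hC, hsep, hcard⟩ := exists_codebook hR ρ hρ
  have hV : 0 < ∑ i, ∏ j, (2 * ρ i j + 1) ^ 2 :=
    Finset.sum_pos (fun i _ => Finset.prod_pos fun j _ => by have := hρ i j; positivity)
      Finset.univ_nonempty
  have hle : I.card ≤ C.card := by
    have := le_of_mul_le_mul_right (hI.trans hcard) hV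
    exact_mod_cast this
  obtain ⟨φ⟩ : Nonempty (I ↪ C) := by
    exact Function.Embedding.nonempty_of_card_le (by simpa using hle)
  refine ⟨fun x => if h : x ∈ I then φ ⟨x, h⟩ else 0, fun x j => ?_, fun i x hx y hy h => ?_⟩
  · by_cases h : x ∈ I
    · simpa [h] using hC _ (φ ⟨x, h⟩).2 j
    · simpa [h] using hR
  · simp only [hx, hy, dite_true] at h
    have := hsep i _ (φ ⟨x, hx⟩).2 _ (φ ⟨y, hy⟩).2 h
    exact congrArg Subtype.val (φ.injective (Subtype.ext this))

/-! ### Messages and payloads -/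

section Message

variable {N T L : ℕ} {K : Fin 2 → ℕ} {alph : Fin 2 → ℕ → Fin 2 → Finset ℂ}

/-- The messages of user `i`: for each block a common part and private symbols. -/
abbrev Message (N T L : ℕ) (K : Fin 2 → ℕ) (alph : Fin 2 → ℕ → Fin 2 → Finset ℂ) (i : Fin 2) :
    Type :=
  (s : Fin N) → Fin (K i) × ((j : Fin T) → (l : Fin 2) → alph i (s * L + j) l)

/-- The payload of a message pair; nothing is sent after the first `N` blocks. -/
def toPayload (w : ∀ i, Message N T L K alph i) : Payload where
  com i s := if h : s < N then (w i ⟨s, h⟩).1 else 0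
  sym i t l := if h : t / L < N ∧ t % L < T then (w i ⟨t / L, h.1⟩).2 ⟨t % L, h.2⟩ l else 0

lemma sym_toPayload_mem (h0 : ∀ i t l, 0 ∈ alph i t l) (w : ∀ i, Message N T L K alph i)
    (i : Fin 2) (t : ℕ) (l : Fin 2) : (toPayload w).sym i t l ∈ alph i t l := by
  simp only [toPayload]
  split_ifs with h
  · have := ((w i ⟨t / L, h.1⟩).2 ⟨t % L, h.2⟩ l).2
    simpa only [Nat.div_add_mod'] using this
  · exact h0 i t l

lemma com_toPayload_lt (hK : ∀ i, 0 < K i) (w : ∀ i, Message N T L K alph i) (i : Fin 2) (s : ℕ) :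
    (toPayload w).com i s < K i := by
  simp only [toPayload]
  split_ifs with h
  · exact Fin.is_lt _
  · exact hK i

lemma message_eq {w w' : ∀ i, Message N T L K alph i} (hL : T ≤ L) {i : Fin 2}
    (h : ∀ s < N, (toPayload w).com i s = (toPayload w').com i s ∧
      ∀ j < T, (toPayload w).sym i (s * L + j) = (toPayload w').sym i (s * L + j)) :
    w i = w' i := by
  funext s
  obtain ⟨hc, hsym⟩ := h s s.2
  refine Prod.ext (Fin.ext (by simpa [toPayload] using hc)) ?_
  funext j l
  have hLj : (j : ℕ) < L := j.2.trans_le hL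
  have hd : (s * L + j) / L = s := by
    rw [mul_comm, Nat.mul_add_div (by omega), Nat.div_eq_of_lt hLj, add_zero]
  have hm : (s * L + j : ℕ) % L = j := by
    rw [mul_comm, Nat.mul_add_mod, Nat.mod_eq_of_lt hLj]
  -- The type of a symbol depends on its slot, so the quotient and remainder are replaced after
  -- coercion to `ℂ`.
  have key : ∀ (w : ∀ i, Message N T L K alph i) (q r : ℕ) (hq : q < N) (hr : r < T),
      q = s → r = j → ((w i ⟨q, hq⟩).2 ⟨r, hr⟩ l : ℂ) = (w i s).2 j l := by
    rintro w q r hq hr rfl rfl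
    rfl
  have h1 := congrFun (hsym j j.2) l
  have hcond : (s * L + j : ℕ) / L < N ∧ (s * L + j : ℕ) % L < T := by
    rw [hd, hm]
    exact ⟨s.2, j.2⟩
  simp only [toPayload, hcond, and_self, dite_true] at h1
  rw [key w _ _ _ _ hd hm, key w' _ _ _ _ hd hm] at h1
  exact Subtype.ext h1

lemma card_message (i : Fin 2) : Fintype.card (Message N T L K alph i) =
    ∏ s : Fin N, (K i * ∏ j : Fin T, ∏ l, (alph i (s * L + j) l).card) := by
  simp [Message, Fintype.card_prod, Fintype.card_pi]

end Message

lemma card_indices {M : ℕ} (𝒮 : Scheme M) (K : Fin 2 → ℕ) (s : ℕ) : (𝒮.indices K s).card =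
    (∏ i, K i) * ∏ k, ∏ j : Fin 𝒮.T, (2 * 𝒮.R k ((s - 1) * 𝒮.L + j) + 1) ^ 2 := by
  have : ∀ R : ℕ, ((R : ℤ) + 1 + R).toNat = 2 * R + 1 := by intro R; omega
  simp [Scheme.indices, Fintype.card_piFinset, Int.card_Icc, this, pow_two]

/-! ### The code at a fixed SNR -/

/-- The codes of the block-Markov scheme at a fixed SNR `P`. -/
theorem exists_blockMarkov_code {M : ℕ} {Ω : Type*} [MeasurableSpace Ω] {μ : Measure Ω}
    [IsProbabilityMeasure μ] (S : FadingCSIT M μ) (b : Fin 2 → CVec M) {P B : ℝ} (hP : 0 ≤ P)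
    (hB : 1 ≤ B) (hb : 5 * (‖b 0‖ + ‖b 1‖) ≤ B) {A A' : Fin 2 → ℕ → ℝ}
    (hA : ∀ k t, A' k t ≤ A k t) (hA' : ∀ k t, 1 ≤ A' k t) (hAP : ∀ k t, A k t ≤ √P)
    {T η N n : ℕ} (hn : (N + 1) * (T + η) ≤ n) {K : Fin 2 → ℕ} (hK : ∀ i, 0 < K i)
    (hsize : ∀ s ≤ N, ((∏ i, (K i : ℝ)) * ∏ k, ∏ j : Fin T,
      (2 * (⌈8 * B * A' k ((s - 1) * (T + η) + j) + 1⌉₊ : ℝ) + 1) ^ 2) *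
      ∑ i, ∏ j : Fin T, (2 * (20 * B ^ 2 * A i (s * (T + η) + j)) + 1) ^ 2 ≤
        ((√P / (2 * B)) ^ 2) ^ T)
    (G : Set Ω) (hG : ∀ ω ∈ G, ∀ t < n, GoodSlot B (fun k => A k t) (fun k => A' k t)
      (fun k => eff b (S.H k t ω)) (fun k => eff b (S.Hhat P k t t ω))
      (fun k => eff b (S.Hhat P k t (t + η) ω))) :
    ∃ (m : Fin 2 → ℕ) (c : Code M n m), c.PowerConstraint S P ∧
      c.errorProb S P ≤ μ Gᶜ + noiseLaw n {z | ∀ i t, ‖z i t‖ ≤ B}ᶜ ∧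
      ∀ i, ∏ s : Fin N, ((K i : ℝ) * ∏ j : Fin T,
        ((A (1 - i) (s * (T + η) + j) / (90 * B ^ 4)) ^ 2 *
          (A' (1 - i) (s * (T + η) + j) / (90 * B ^ 4)) ^ 2)) ≤ m i := by
  classical
  have hB0 : 0 < B := by linarith
  have hA'0 : ∀ k t, 0 < A' k t := fun k t => by linarith [hA' k t]
  have hA0 : ∀ k t, 0 < A k t := fun k t => (hA'0 k t).trans_le (hA k t)
  let amp : Fin 2 → ℕ → Fin 2 → ℝ := fun i t => ![A (1 - i) t, A' (1 - i) t]
  have hamp : ∀ i t l, 0 < amp i t l := fun i t =>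
    Fin.forall_fin_two.2 ⟨hA0 _ _, hA'0 _ _⟩
  have hampP : ∀ i t l, amp i t l ≤ √P := fun i t =>
    Fin.forall_fin_two.2 ⟨hAP _ _, (hA _ _).trans (hAP _ _)⟩
  have hconst : ∀ i t l, ∃ X : Finset ℂ, 0 ∈ X ∧ (amp i t l / (90 * B ^ 4)) ^ 2 ≤ X.card ∧
      (∀ a ∈ X, ‖a‖ ≤ amp i t l / B) ∧
      ∀ a ∈ X, ∀ a' ∈ X, ‖a - a'‖ ≤ 44 * B ^ 3 → a = a' := by
    intro i t l
    -- The spacing strictly exceeds the ambiguity `44 * B ^ 3` of `GoodSlot.norm_symbol_le`.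
    -- Amplitudes come out as `amp / B`; this spare factor pays for the norms of the directions in
    -- the power constraint.
    obtain ⟨X, h0, hc, hn, hs⟩ := exists_constellation (D := 45 * B ^ 3)
      (R := amp i t l / (90 * B ^ 4)) (by positivity) (div_pos (hamp i t l) (by positivity))
    refine ⟨X, h0, hc, fun a ha => (hn a ha).trans_eq ?_, fun a ha a' ha' h => hs a ha a' ha' ?_⟩
    · field_simp
      ring
    · have : 0 < B ^ 3 := by positivity
      linarith
  choose alph h0 hcard hnorm hsep using hconst
  let R : Fin 2 → ℕ → ℕ := fun k t => ⌈8 * B * A' k t + 1⌉₊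
  let 𝒮₀ : Scheme M := ⟨b, T, η, R, fun _ _ _ => 0⟩
  have hcbex : ∀ s, ∃ cb : (Fin 2 → ℕ) × (Fin 2 → Fin T → ℤ × ℤ) → Fin T → ℂ,
      (∀ x j, ‖cb x j‖ ≤ √P / B) ∧ (s ≤ N → ∀ i, ∀ x ∈ 𝒮₀.indices K s, ∀ y ∈ 𝒮₀.indices K s,
        (∀ j : Fin T, ‖cb x j - cb y j‖ ≤ 20 * B ^ 2 * A i (s * (T + η) + j)) → x = y) := by
    intro s
    by_cases hs : s ≤ N
    · obtain ⟨cb, h1, h2⟩ := exists_encoding (R := √P / (2 * B)) (by positivity)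
        (fun i (j : Fin T) => 20 * B ^ 2 * A i (s * (T + η) + j))
        (fun i j => by have := hA0 i (s * (T + η) + j); positivity) (𝒮₀.indices K s) (by
          refine le_of_eq_of_le ?_ (hsize s hs)
          rw [card_indices]
          push_cast
          rfl)
      refine ⟨cb, fun x j => (h1 x j).trans_eq ?_, fun _ => h2⟩
      field_simp
    · exact ⟨fun _ _ => 0, fun x j => by simpa using by positivity, fun h => (hs h).elim⟩
  choose cb hcbn hcbs using hcbex
  let 𝒮 : Scheme M := ⟨b, T, η, R, cb⟩
  have hind : ∀ s, 𝒮.indices K s = 𝒮₀.indices K s := fun s => rfl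
  let W : Fin 2 → Type := fun i => Message N T (T + η) K alph i
  have : ∀ i, Nonempty (W i) := fun i =>
    ⟨fun s => (⟨0, hK i⟩, fun j l => ⟨0, h0 _ _ _⟩)⟩
  let x : ℕ → (∀ i, W i) → (Fin 2 → ℕ → ℕ → CVec M) → CVec M := fun t w E =>
    𝒮.input E (toPayload w) t
  have hsymB : ∀ (w : ∀ i, W i) i t l, ‖(toPayload w).sym i t l‖ ≤ amp i t l / B :=
    fun w i t l => hnorm i t l _ (sym_toPayload_mem h0 w i t l)
  have hsym : ∀ (w : ∀ i, W i) i t l, ‖(toPayload w).sym i t l‖ ≤ amp i t l :=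
    fun w i t l => (hsymB w i t l).trans (div_le_self (hamp i t l).le hB)
  obtain ⟨c, hpow, herr⟩ := exists_code_of_separation (n := n) S (P := P) (r := B) W x
    (fun t w => Scheme.measurable_input _ _)
    (fun t w E E' h => Scheme.input_causal _ _ _ _ h)
    (fun t w E => by
      have h1 : ‖x t w E‖ ≤ 5 * (√P / B) * (‖b 0‖ + ‖b 1‖) :=
        Scheme.norm_input_le (𝒮 := 𝒮) (p := √P / B) (by positivity) hcbn
          (fun i t l => (hsymB w i t l).trans (by gcongr; exact hampP i t l)) t
      have h2 : ‖x t w E‖ ≤ √P := by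
        refine h1.trans ?_
        calc 5 * (√P / B) * (‖b 0‖ + ‖b 1‖) = (5 * (‖b 0‖ + ‖b 1‖)) * (√P / B) := by ring
          _ ≤ B * (√P / B) := by gcongr
          _ = √P := by field_simp
      calc ‖x t w E‖ ^ 2 ≤ √P ^ 2 := by gcongr
        _ = P := Real.sq_sqrt hP) G (by
      intro ω hω i w w' hout
      have hslot : ∀ s ≤ N, ∀ j < T, s * (T + η) + j < n := by
        intro s hs j hj
        calc s * (T + η) + j < s * (T + η) + (T + η) := by omega
          _ = (s + 1) * (T + η) := by ring
          _ ≤ (N + 1) * (T + η) := by gcongr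
          _ ≤ n := hn
      refine message_eq (Nat.le_add_right T η) fun s hs => ?_
      refine Scheme.payload_eq_of_output_close (𝒮 := 𝒮)
        (E := fun j τ t' => S.Hhat P j τ t' ω) hB hA hA'
        (fun k t => Nat.le_ceil _) (h := fun k t => S.H k t ω) (S := N)
        (fun s hs j hj => hG ω hω _ (hslot s hs j hj))
        (fun i t => ⟨hsym w i t 0, hsym w i t 1⟩) (fun i t => ⟨hsym w' i t 0, hsym w' i t 1⟩)
        (fun i j hj => ?_)
        (fun i t l => hsep i t l _ (sym_toPayload_mem h0 w i t l) _ (sym_toPayload_mem h0 w' i t l))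
        i (fun s hs => hcbs s hs (1 - i)
          _ (hind s ▸ Scheme.index_mem fun i => com_toPayload_lt hK w i s)
          _ (hind s ▸ Scheme.index_mem fun i => com_toPayload_lt hK w' i s))
        (fun s hs j hj => hout _ (hslot s hs j hj)) s hs.le
      -- Block `N`, after the `N` data blocks, carries no private symbols and starts the backward
      -- decoding.
      have hdiv : ¬ (N * 𝒮.L + j) / (T + η) < N := by
        have := (Scheme.slot_div_mod (𝒮 := 𝒮) (s := N) hj).1
        rw [show 𝒮.L = T + η from rfl] at this ⊢
        omega
      constructor <;> (ext l; simp [toPayload, hdiv]))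
  refine ⟨_, c, hpow, herr, fun i => ?_⟩
  rw [card_message]
  push_cast
  refine Finset.prod_le_prod (fun s _ => ?_) fun s _ => ?_
  · exact mul_nonneg (by positivity) (Finset.prod_nonneg fun j _ => by positivity)
  · refine mul_le_mul_of_nonneg_left (Finset.prod_le_prod (fun j _ => by positivity) fun j _ => ?_)
      (by positivity)
    rw [Fin.prod_univ_two]
    exact mul_le_mul (hcard i _ 0) (hcard i _ 1) (by positivity) (by positivity)

/-! ### Window averages and power profiles -/

lemma HasWindowAverage.add {a a' : ℕ → ℝ} {x x' : ℝ} (h : HasWindowAverage a x)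
    (h' : HasWindowAverage a' x') : HasWindowAverage (fun t => a t + a' t) (x + x') := by
  intro ε hε
  obtain ⟨T₁, h₁⟩ := h (ε / 2) (by positivity)
  obtain ⟨T₂, h₂⟩ := h' (ε / 2) (by positivity)
  refine ⟨max T₁ T₂, fun T hT τ => ?_⟩
  rw [Finset.sum_add_distrib, add_div, add_sub_add_comm]
  refine (abs_add_le _ _).trans ?_
  linarith [h₁ T (le_trans (le_max_left _ _) hT) τ, h₂ T (le_trans (le_max_right _ _) hT) τ]

lemma HasWindowAverage.const_mul {a : ℕ → ℝ} {x : ℝ} (h : HasWindowAverage a x) (c : ℝ) :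
    HasWindowAverage (fun t => c * a t) (c * x) := by
  intro ε hε
  obtain ⟨T₁, h₁⟩ := h (ε / (|c| + 1)) (by positivity)
  refine ⟨T₁, fun T hT τ => ?_⟩
  rw [← Finset.mul_sum, mul_div_assoc, ← mul_sub, abs_mul]
  calc _ ≤ |c| * (ε / (|c| + 1)) := by gcongr; exact h₁ T hT τ
    _ ≤ (|c| + 1) * (ε / (|c| + 1)) := by gcongr; linarith
    _ = ε := by field_simp

lemma HasWindowAverage.nonneg {a : ℕ → ℝ} {x : ℝ} (h : HasWindowAverage a x) (h0 : ∀ t, 0 ≤ a t) :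
    0 ≤ x := by
  refine le_of_forall_pos_le_add fun ε hε => ?_
  obtain ⟨T, hT⟩ := h ε hε
  have h2 : 0 ≤ (∑ t ∈ Finset.range T, a (0 + t)) / (T : ℝ) :=
    div_nonneg (Finset.sum_nonneg fun t _ => h0 _) (by positivity)
  linarith [(abs_le.1 (hT T le_rfl 0)).2]

/-- Uniformity in the window's position lets one block length `T` serve all blocks. -/
lemma HasWindowAverage.exists_sum_bounds {a : ℕ → ℝ} {x : ℝ} (h : HasWindowAverage a x) {ε : ℝ}
    (hε : 0 < ε) : ∃ T₀ : ℕ, ∀ T : ℕ, T₀ ≤ T → ∀ τ : ℕ,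
      T * (x - ε) ≤ ∑ j : Fin T, a (τ + j) ∧ ∑ j : Fin T, a (τ + j) ≤ T * (x + ε) := by
  obtain ⟨T₀, h₀⟩ := h ε hε
  refine ⟨T₀ + 1, fun T hT τ => ?_⟩
  have h1 := abs_le.1 (h₀ T (by omega) τ)
  have hT0 : (0 : ℝ) < T := by exact_mod_cast (by omega : 0 < T)
  rw [Finset.sum_range] at h1
  have e : ∑ j : Fin T, a (τ + j) = T * ((∑ j : Fin T, a (τ + j)) / T) := by field_simp
  rw [e]
  constructor <;> gcongr <;> linarith

/-- Power exponents below the delayed quality exponents with a prescribed average, whose excess over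
the current quality exponents is as small as possible on average. -/
lemma exists_power_profile {α β : ℕ → ℝ} {a b d : ℝ} (h : ∀ t, 0 ≤ α t ∧ α t ≤ β t)
    (hα : HasWindowAverage α a) (hβ : HasWindowAverage β b) (hd : 0 ≤ d) (hdb : d ≤ b) :
    ∃ δ : ℕ → ℝ, (∀ t, 0 ≤ δ t ∧ δ t ≤ β t) ∧ HasWindowAverage δ d ∧
      HasWindowAverage (fun t => max (δ t - α t) 0) (max (d - a) 0) := by
  have ha := hα.nonneg fun t => (h t).1
  rcases le_or_gt d a with hda | hda
  -- Below the current quality, scale `α` down, so that there is no excess.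
  · obtain ⟨θ, hθ0, hθ1, hθ⟩ : ∃ θ : ℝ, 0 ≤ θ ∧ θ ≤ 1 ∧ θ * a = d := by
      rcases ha.eq_or_lt with ha0 | ha0
      · exact ⟨0, le_rfl, zero_le_one, by linarith⟩
      · exact ⟨d / a, by positivity, (div_le_one ha0).2 hda, by field_simp⟩
    have hle : ∀ t, θ * α t ≤ α t := fun t => mul_le_of_le_one_left (h t).1 hθ1
    refine ⟨fun t => θ * α t, fun t => ⟨mul_nonneg hθ0 (h t).1, (hle t).trans (h t).2⟩,
      hθ ▸ hα.const_mul θ, ?_⟩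
    have h1 : (fun t => max (θ * α t - α t) 0) = fun t => 0 * α t := by
      ext t
      rw [zero_mul, max_eq_right (by linarith [hle t])]
    have h2 := hα.const_mul 0
    rw [zero_mul a] at h2
    rwa [h1, max_eq_right (by linarith)]
  -- Above it, interpolate between `α` and `β`; the excess is then nonnegative in every slot and
  -- averages to `d - a`.
  · have hba : 0 < b - a := by linarith
    obtain ⟨θ, hθ0, hθ1, hθ⟩ : ∃ θ : ℝ, 0 ≤ θ ∧ θ ≤ 1 ∧ θ * (b - a) = d - a :=
      ⟨(d - a) / (b - a), div_nonneg (by linarith) hba.le, (div_le_one hba).2 (by linarith),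
        by field_simp⟩
    have hav : HasWindowAverage (fun t => θ * (β t + -1 * α t)) (d - a) := by
      rw [← hθ, show b - a = b + -1 * a by ring]
      exact (hβ.add (hα.const_mul (-1))).const_mul θ
    have h0 : ∀ t, 0 ≤ θ * (β t + -1 * α t) := fun t => mul_nonneg hθ0 (by linarith [(h t).2])
    have h1 : ∀ t, θ * (β t + -1 * α t) ≤ β t - α t := fun t => by
      have := mul_le_mul_of_nonneg_right hθ1 (show 0 ≤ β t + -1 * α t by linarith [(h t).2])
      linarith
    refine ⟨fun t => α t + θ * (β t + -1 * α t),
      fun t => ⟨add_nonneg (h t).1 (h0 t), by linarith [h1 t]⟩, ?_, ?_⟩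
    · have := hα.add hav
      rwa [add_sub_cancel] at this
    · have e : (fun t => max (α t + θ * (β t + -1 * α t) - α t) 0) =
          fun t => θ * (β t + -1 * α t) := by
        ext t
        rw [add_sub_cancel_left, max_eq_left (h0 t)]
      rw [e, max_eq_left (by linarith)]
      exact hav

/-! ### Counting exponents -/

lemma sq_rpow_half {P : ℝ} (hP : 0 < P) (x : ℝ) : (P ^ (x / 2)) ^ 2 = P ^ x := by
  rw [← Real.rpow_natCast, ← Real.rpow_mul hP.le]
  congr 1
  push_cast
  ring

lemma pow_mul_rpow_half_sq {P : ℝ} (hP : 0 < P) (κ x : ℝ) (k : ℕ) :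
    ((P ^ κ) ^ k * P ^ (x / 2)) ^ 2 = P ^ (2 * k * κ + x) := by
  rw [mul_pow, sq_rpow_half hP, Real.rpow_add hP, ← pow_mul, ← Real.rpow_natCast,
    ← Real.rpow_mul hP.le]
  congr 2
  push_cast
  ring

/-- The number of codebook indices in a block is within the packing bound. -/
lemma codebook_size_le {P κ ε' dbar : ℝ} {T : ℕ} {C q : Fin 2 → ℝ} {u v : Fin 2 → Fin T → ℝ}
    (hP : 1 ≤ P) (hT : 1 ≤ T) (hκ : 0 < κ) (hB : 100 ≤ P ^ κ) (hC : ∀ i, 0 ≤ C i)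
    (hu0 : ∀ k j, 0 ≤ u k j) (hv0 : ∀ k j, 0 ≤ v k j)
    (hu : ∀ k, ∑ j, u k j ≤ T * (q k + ε')) (hv : ∀ k, ∑ j, v k j ≤ T * (dbar + ε'))
    (hsum : C 0 + C 1 + q 0 + q 1 + dbar + 3 * ε' + 20 * κ ≤ 1) :
    ((∏ i, (⌈P ^ (T * C i)⌉₊ : ℝ)) * ∏ k, ∏ j,
      (2 * (⌈8 * P ^ κ * P ^ (u k j / 2) + 1⌉₊ : ℝ) + 1) ^ 2) *
      ∑ i, ∏ j, (2 * (20 * (P ^ κ) ^ 2 * P ^ (v i j / 2)) + 1) ^ 2 ≤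
        ((√P / (2 * P ^ κ)) ^ 2) ^ T := by
  have hP0 : 0 < P := by linarith
  have hT' : (1 : ℝ) ≤ T := by exact_mod_cast hT
  set B := P ^ κ with hBdef
  have hBT : B ≤ P ^ (T * κ) := Real.rpow_le_rpow_of_exponent_le hP (by nlinarith)
  have hone : ∀ x : ℝ, 0 ≤ x → 1 ≤ P ^ (x : ℝ) := fun x hx => Real.one_le_rpow hP hx
  have hKi : ∀ i, (⌈P ^ (T * C i)⌉₊ : ℝ) ≤ P ^ (T * (C i + κ)) := by
    intro i
    have h1 := hone (T * C i) (mul_nonneg (by positivity) (hC i))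
    calc (⌈P ^ (T * C i)⌉₊ : ℝ) ≤ P ^ (T * C i) + 1 := (Nat.ceil_lt_add_one (by positivity)).le
      _ ≤ P ^ (T * C i) * B := by nlinarith
      _ ≤ P ^ (T * C i) * P ^ (T * κ) := by gcongr
      _ = P ^ (T * (C i + κ)) := by rw [← Real.rpow_add hP0]; congr 1; ring
  have hQ : ∀ k, ∏ j, (2 * (⌈8 * B * P ^ (u k j / 2) + 1⌉₊ : ℝ) + 1) ^ 2 ≤
      P ^ (T * (4 * κ + q k + ε')) := by
    intro k
    calc _ ≤ ∏ j, P ^ (4 * κ + u k j) := by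
          refine Finset.prod_le_prod (fun j _ => by positivity) fun j _ => ?_
          have h1 := hone (u k j / 2) (by linarith [hu0 k j])
          have h2 := (Nat.ceil_lt_add_one
            (show 0 ≤ 8 * B * P ^ (u k j / 2) + 1 by positivity)).le
          have h3 : (B ^ 2 * P ^ (u k j / 2)) ^ 2 = P ^ (4 * κ + u k j) := by
            rw [pow_mul_rpow_half_sq hP0]
            norm_num
          rw [← h3]
          gcongr
          have h4 : 1 ≤ B * P ^ (u k j / 2) := by nlinarith
          calc _ ≤ 2 * (8 * B * P ^ (u k j / 2) + 1 + 1) + 1 := by linarith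
            _ ≤ 21 * (B * P ^ (u k j / 2)) := by linarith
            _ ≤ B * (B * P ^ (u k j / 2)) := by gcongr; linarith
            _ = _ := by ring
      _ = P ^ (∑ j, (4 * κ + u k j)) := (Real.rpow_sum_of_pos hP0 _ _).symm
      _ ≤ _ := by
          refine Real.rpow_le_rpow_of_exponent_le hP ?_
          rw [Finset.sum_add_distrib]
          simp only [Finset.sum_const, Finset.card_univ, Fintype.card_fin, nsmul_eq_mul]
          linarith [hu k]
  have hV : ∀ i, ∏ j, (2 * (20 * B ^ 2 * P ^ (v i j / 2)) + 1) ^ 2 ≤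
      P ^ (T * (6 * κ + dbar + ε')) := by
    intro k
    calc _ ≤ ∏ j, P ^ (6 * κ + v k j) := by
          refine Finset.prod_le_prod (fun j _ => by positivity) fun j _ => ?_
          have h1 := hone (v k j / 2) (by linarith [hv0 k j])
          have h3 : (B ^ 3 * P ^ (v k j / 2)) ^ 2 = P ^ (6 * κ + v k j) := by
            rw [pow_mul_rpow_half_sq hP0]
            norm_num
          rw [← h3]
          gcongr
          have h4 : 1 ≤ B ^ 2 * P ^ (v k j / 2) := by nlinarith
          calc _ ≤ 41 * (B ^ 2 * P ^ (v k j / 2)) := by linarith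
            _ ≤ B * (B ^ 2 * P ^ (v k j / 2)) := by gcongr; linarith
            _ = _ := by ring
      _ = P ^ (∑ j, (6 * κ + v k j)) := (Real.rpow_sum_of_pos hP0 _ _).symm
      _ ≤ _ := by
          refine Real.rpow_le_rpow_of_exponent_le hP ?_
          rw [Finset.sum_add_distrib]
          simp only [Finset.sum_const, Finset.card_univ, Fintype.card_fin, nsmul_eq_mul]
          linarith [hv k]
  have hVsum : ∑ i, ∏ j, (2 * (20 * B ^ 2 * P ^ (v i j / 2)) + 1) ^ 2 ≤
      P ^ (T * (7 * κ + dbar + ε')) := by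
    calc _ ≤ ∑ _i : Fin 2, P ^ (T * (6 * κ + dbar + ε')) := Finset.sum_le_sum fun i _ => hV i
      _ = 2 * P ^ (T * (6 * κ + dbar + ε')) := by simp
      _ ≤ P ^ (T * κ) * P ^ (T * (6 * κ + dbar + ε')) := by gcongr; linarith
      _ = _ := by rw [← Real.rpow_add hP0]; congr 1; ring
  have hRHS : P ^ (T * (1 - 3 * κ)) ≤ ((√P / (2 * B)) ^ 2) ^ T := by
    rw [mul_comm, Real.rpow_mul hP0.le, Real.rpow_natCast]
    gcongr
    rw [div_pow, Real.sq_sqrt hP0.le, Real.rpow_sub hP0, Real.rpow_one]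
    have h3 : P ^ (3 * κ) = B ^ 3 := by
      rw [hBdef, ← Real.rpow_natCast, ← Real.rpow_mul hP0.le]
      congr 1
      push_cast
      ring
    rw [h3]
    gcongr
    nlinarith [sq_nonneg B]
  refine le_trans ?_ hRHS
  rw [Fin.prod_univ_two, Fin.prod_univ_two]
  -- The slack is `2κ` for the common messages, `8κ` for the quantizers and `7κ` for the packing;
  -- with the `3κ` lost on the right this is the `20κ` of `hsum`.
  calc _ ≤ ((P ^ (T * (C 0 + κ)) * P ^ (T * (C 1 + κ))) * (P ^ (T * (4 * κ + q 0 + ε')) *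
        P ^ (T * (4 * κ + q 1 + ε')))) * P ^ (T * (7 * κ + dbar + ε')) := by
        have hn0 : ∀ k, 0 ≤ ∏ j, (2 * (⌈8 * B * P ^ (u k j / 2) + 1⌉₊ : ℝ) + 1) ^ 2 :=
          fun k => Finset.prod_nonneg fun j _ => by positivity
        have hn1 : 0 ≤ ∑ i, ∏ j, (2 * (20 * B ^ 2 * P ^ (v i j / 2)) + 1) ^ 2 :=
          Finset.sum_nonneg fun i _ => Finset.prod_nonneg fun j _ => by positivity
        exact mul_le_mul (mul_le_mul (mul_le_mul (hKi 0) (hKi 1) (by positivity) (by positivity))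
          (mul_le_mul (hQ 0) (hQ 1) (hn0 1) (by positivity))
          (mul_nonneg (hn0 0) (hn0 1)) (by positivity)) hVsum hn1 (by positivity)
    _ = P ^ (T * (C 0 + C 1 + q 0 + q 1 + dbar + 3 * ε' + 17 * κ)) := by
        rw [← Real.rpow_add hP0, ← Real.rpow_add hP0, ← Real.rpow_add hP0, ← Real.rpow_add hP0]
        congr 1
        ring
    _ ≤ _ := by
        refine Real.rpow_le_rpow_of_exponent_le hP ?_
        gcongr
        linarith

/-- A lower bound for the number of messages sent in one block. -/
lemma le_block_message_count {P κ ε' dbar C q : ℝ} {T : ℕ} {u v : Fin T → ℝ} (hP : 1 ≤ P)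
    (hB : 8100 ≤ P ^ κ) (hu : T * (q - ε') ≤ ∑ j, u j) (hv : T * (dbar - ε') ≤ ∑ j, v j) :
    P ^ (T * (C + dbar + q - 2 * ε' - 18 * κ)) ≤ (⌈P ^ (T * C)⌉₊ : ℝ) *
      ∏ j, ((P ^ (v j / 2) / (90 * (P ^ κ) ^ 4)) ^ 2 *
        (P ^ (u j / 2) / (90 * (P ^ κ) ^ 4)) ^ 2) := by
  have hP0 : 0 < P := by linarith
  have key : ∀ x : ℝ, P ^ (x - 9 * κ) ≤ (P ^ (x / 2) / (90 * (P ^ κ) ^ 4)) ^ 2 := by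
    intro x
    rw [div_pow, sq_rpow_half hP0, Real.rpow_sub hP0]
    have h9 : P ^ (9 * κ) = (P ^ κ) ^ 9 := by
      rw [← Real.rpow_natCast, ← Real.rpow_mul hP0.le]
      congr 1
      push_cast
      ring
    rw [h9]
    have h8 : 0 < (P ^ κ) ^ 8 := by positivity
    gcongr
    calc (90 * (P ^ κ) ^ 4) ^ 2 = 8100 * (P ^ κ) ^ 8 := by ring
      _ ≤ P ^ κ * (P ^ κ) ^ 8 := by gcongr
      _ = (P ^ κ) ^ 9 := by ring
  calc _ ≤ P ^ (T * C) * P ^ (∑ j, ((v j - 9 * κ) + (u j - 9 * κ))) := by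
        rw [← Real.rpow_add hP0]
        refine Real.rpow_le_rpow_of_exponent_le hP ?_
        simp only [Finset.sum_add_distrib, Finset.sum_sub_distrib, Finset.sum_const,
          Finset.card_univ, Fintype.card_fin, nsmul_eq_mul]
        linarith
    _ ≤ _ := by
        gcongr
        · exact Nat.le_ceil _
        · rw [Real.rpow_sum_of_pos hP0]
          refine Finset.prod_le_prod (fun j _ => by positivity) fun j _ => ?_
          rw [Real.rpow_add hP0]
          exact mul_le_mul (key _) (key _) (by positivity) (by positivity)

/-! ### Good slots and bounded noise -/

/-- With high probability a slot is good for the amplitudes `P ^ (δ k / 2)`. -/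
lemma highProb_goodSlot {M : ℕ} {Ω : Type*} [MeasurableSpace Ω] {μ : Measure Ω}
    [IsProbabilityMeasure μ] (S : FadingCSIT M μ) {b : Fin 2 → CVec M} {t η : ℕ}
    {α β δ : Fin 2 → ℝ} {κ : ℝ} (hκ : 0 < κ)
    (hb0 : ∀ i, ∀ᵐ ω ∂μ, eff b (S.H i t ω) 0 ≠ 0)
    (hdet : ∀ᵐ ω ∂μ, eff b (S.H 0 t ω) 0 * eff b (S.H 1 t ω) 1 -
      eff b (S.H 0 t ω) 1 * eff b (S.H 1 t ω) 0 ≠ 0)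
    (hα : ∀ i, IsQualityExponent μ (fun P ω => S.H i t ω - S.Hhat P i t t ω) (α i))
    (hβ : ∀ i, IsQualityExponent μ (fun P ω => S.H i t ω - S.Hhat P i t (t + η) ω) (β i))
    (hδ : ∀ i, δ i ≤ β i) :
    HighProb μ fun P ω => GoodSlot (P ^ κ) (fun k => P ^ (δ k / 2))
      (fun k => P ^ (max (δ k - α k) 0 / 2)) (fun k => eff b (S.H k t ω))
      (fun k => eff b (S.Hhat P k t t ω)) (fun k => eff b (S.Hhat P k t (t + η) ω)) := by
  have hlim : Tendsto (fun P : ℝ => P ^ κ) atTop atTop := tendsto_rpow_atTop hκ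
  have hlim2 : Tendsto (fun P : ℝ => P ^ (κ / 2)) atTop atTop := tendsto_rpow_atTop (by positivity)
  have hmeas : ∀ i l, Measurable fun ω => eff b (S.H i t ω) l := fun i l =>
    (measurable_eff b l).comp (S.measurable_H i t)
  have h1 : HighProb μ fun P ω => ∀ i l, ‖eff b (S.H i t ω) l‖ ≤ P ^ κ :=
    HighProb.forall fun i => HighProb.forall fun l => highProb_le_of_tendsto (hmeas i l).norm hlim
  have h2 : HighProb μ fun P ω => ∀ i, 1 ≤ P ^ κ * ‖eff b (S.H i t ω) 0‖ :=
    HighProb.forall fun i => highProb_norm_ge_of_tendsto (hmeas i 0) (hb0 i) hlim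
  have h3 := highProb_norm_ge_of_tendsto (((hmeas 0 0).mul (hmeas 1 1)).sub
    ((hmeas 0 1).mul (hmeas 1 0))) hdet hlim
  have h4 := HighProb.forall fun i => (hα i).highProb (half_pos hκ)
  have h5 := HighProb.forall fun i => (hβ i).highProb (half_pos hκ)
  refine (h1.and (h2.and (h3.and (h4.and h5)))).mono ?_
  have hc : ∀ᶠ P : ℝ in atTop, ∀ l, ∑ k, ‖b l k‖ ≤ P ^ (κ / 2) :=
    eventually_all.2 fun l => hlim2.eventually_ge_atTop _
  filter_upwards [hc, eventually_ge_atTop 1] with P hc hP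
  refine Eventually.of_forall fun ω ⟨g1, g2, g3, g4, g5⟩ => ?_
  have hP0 : 0 < P := by linarith
  have herr : ∀ (v v' : CVec M) (a d : ℝ) (l : Fin 2), ‖v - v'‖ ≤ P ^ (-a / 2 + κ / 2) →
      ‖eff b v l - eff b v' l‖ * P ^ (d / 2) ≤ P ^ (κ + (d - a) / 2) := by
    intro v v' a d l h
    rw [eff_sub]
    calc _ ≤ (‖v - v'‖ * ∑ k, ‖b l k‖) * P ^ (d / 2) := by gcongr; exact norm_eff_le _ _ _
      _ ≤ (P ^ (-a / 2 + κ / 2) * P ^ (κ / 2)) * P ^ (d / 2) := by gcongr; exact hc l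
      _ = _ := by
        rw [← Real.rpow_add hP0, ← Real.rpow_add hP0]
        congr 1
        ring
  refine ⟨g1, g2, g3, fun i l => (herr _ _ _ _ l (g4 i)).trans ?_,
    fun i l => (herr _ _ _ _ l (g5 i)).trans ?_⟩
  · rw [← Real.rpow_add hP0]
    refine Real.rpow_le_rpow_of_exponent_le hP ?_
    linarith [le_max_left (δ i - α i) 0]
  · exact Real.rpow_le_rpow_of_exponent_le hP (by linarith [hδ i])

lemma highProb_noise_le (n : ℕ) {κ : ℝ} (hκ : 0 < κ) :
    HighProb (noiseLaw n) fun P z => ∀ i t, ‖z i t‖ ≤ P ^ κ := by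
  have : IsProbabilityMeasure (noiseLaw n) := by unfold noiseLaw; infer_instance
  exact HighProb.forall fun i => HighProb.forall fun t =>
    highProb_le_of_tendsto (by fun_prop) (tendsto_rpow_atTop hκ)

/-! ### Choice of rates and number of blocks -/

/-- The split of the rates between the private streams and the common codeword. -/
lemma exists_rate_split {d a bm : Fin 2 → ℝ} {ε : ℝ} (hε : 0 < ε) (hε1 : ε ≤ 1)
    (hbm : ∀ i, 0 ≤ bm i) (ha : ∀ i, 0 ≤ a i) (h0 : d 0 ≤ 1) (h1 : d 1 ≤ 1)
    (h2 : 2 * d 0 + d 1 ≤ 2 + a 0) (h3 : 2 * d 1 + d 0 ≤ 2 + a 1)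
    (h4 : d 0 + d 1 ≤ 1 + min (bm 0) (bm 1)) :
    ∃ (dbar : ℝ) (C : Fin 2 → ℝ), 0 ≤ dbar ∧ (∀ i, dbar ≤ bm i) ∧ (∀ i, 0 ≤ C i) ∧
      (∀ i, d i - ε ≤ C i + dbar + max (dbar - a (1 - i)) 0) ∧
      C 0 + C 1 + max (dbar - a 0) 0 + max (dbar - a 1) 0 + dbar ≤ 1 - ε := by
  have hm0 := min_le_left (bm 0) (bm 1)
  have hm1 := min_le_right (bm 0) (bm 1)
  rcases le_or_gt (d 0 + d 1 - 1) ε with hc | hc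
  -- For a sum rate near one or below, common messages alone suffice.
  · refine ⟨0, fun i => max (d i - ε) 0, le_rfl, hbm, fun i => le_max_right _ _, fun i => ?_, ?_⟩
    · linarith [le_max_left (d i - ε) 0, le_max_right (0 - a (1 - i)) 0]
    · rw [max_eq_right (by linarith [ha 0] : 0 - a 0 ≤ 0),
        max_eq_right (by linarith [ha 1] : 0 - a 1 ≤ 0)]
      rcases max_cases (d 0 - ε) 0 with h | h <;> rcases max_cases (d 1 - ε) 0 with h' | h' <;>
        linarith
  -- This `D` makes the codeword constraint an equality. Then `C i ≥ 0` amounts, up to `ε`, to the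
  -- single-user and weighted-sum bounds, and `D ≤ bm i` follows from the sum bound.
  · set D := d 0 + d 1 - 1 - ε with hD
    refine ⟨D, fun i => d i - ε - D - max (D - a (1 - i)) 0, by linarith,
      Fin.forall_fin_two.2 ⟨by linarith, by linarith⟩, Fin.forall_fin_two.2 ⟨?_, ?_⟩,
      fun i => by linarith, ?_⟩
    · have : max (D - a 1) 0 ≤ d 0 - ε - D := max_le (by linarith) (by linarith)
      simpa using this
    · have : max (D - a 0) 0 ≤ d 1 - ε - D := max_le (by linarith) (by linarith)
      simpa using this
    · simp only [sub_zero, sub_self]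
      linarith

/-- The number of data blocks in a long block length, and their share of the time. -/
lemma exists_block_count {T η : ℕ} {ε : ℝ} (hε : 0 < ε) (hT : 1 ≤ T) (hη : 4 * η ≤ ε * T) :
    ∀ᶠ n : ℕ in atTop, 0 < n ∧ ∃ N : ℕ, (N + 1) * (T + η) ≤ n ∧ n * (1 - ε / 2) ≤ (N * T : ℕ) := by
  have hlim := tendsto_natCast_atTop_atTop (R := ℝ)
  filter_upwards [eventually_ge_atTop (T + η), hlim.eventually_ge_atTop (8 * T / ε)] with n hn hn'
  have hdiv : 1 ≤ n / (T + η) := (Nat.one_le_div_iff (by omega)).2 hn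
  -- One complete block is reserved for the final interference.
  refine ⟨by omega, n / (T + η) - 1, ?_, ?_⟩
  · rw [Nat.sub_add_cancel hdiv]
    exact Nat.div_mul_le_self _ _
  · obtain ⟨N, hN⟩ : ∃ N, n / (T + η) = N + 1 := ⟨_, (Nat.sub_add_cancel hdiv).symm⟩
    rw [hN, Nat.add_sub_cancel]
    have h1 : n < (N + 1 + 1) * (T + η) := by
      rw [← hN, mul_comm]
      exact Nat.lt_mul_div_succ n (by omega)
    have h2 : (n : ℝ) ≤ (N + 2) * (T + η) := by
      have : (n : ℝ) ≤ ((N + 1 + 1) * (T + η) : ℕ) := by exact_mod_cast h1.le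
      push_cast at this
      linarith
    have hn8 : 8 * (T : ℝ) ≤ ε * n := by
      rw [div_le_iff₀ hε] at hn'
      linarith
    push_cast
    rcases le_or_gt 1 (ε / 4) with h | h
    · have : (n : ℝ) * (1 - ε / 2) ≤ 0 :=
        mul_nonpos_of_nonneg_of_nonpos (by positivity) (by linarith)
      exact this.trans (by positivity)
    · have h3 : (T + η : ℝ) * (1 - ε / 4) ≤ T := by
        have : (0 : ℝ) ≤ η * ε := by positivity
        nlinarith
      have h4 : (n : ℝ) * (1 - ε / 4) ≤ (N + 2) * T := by
        calc (n : ℝ) * (1 - ε / 4) ≤ ((N + 2) * (T + η)) * (1 - ε / 4) := by gcongr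
          _ = (N + 2) * ((T + η) * (1 - ε / 4)) := by ring
          _ ≤ (N + 2) * T := by gcongr
      nlinarith

end MISOBC

end

/-! ### The inner bound -/

theorem proposition1 {M : ℕ} (hM : 2 ≤ M) {Ω : Type*} [MeasurableSpace Ω] (μ : Measure Ω)
    [IsProbabilityMeasure μ] (S : MISOBC.FadingCSIT M μ) (η : ℕ) (hη : 0 < η)
    (α β : Fin 2 → ℕ → ℝ) (αbar βbar : Fin 2 → ℝ)
    (hα : ∀ i t, MISOBC.IsQualityExponent μ (fun P ω => S.H i t ω - S.Hhat P i t t ω) (α i t))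
    (hβ : ∀ i t,
      MISOBC.IsQualityExponent μ (fun P ω => S.H i t ω - S.Hhat P i t (t + η) ω) (β i t))
    (hrange : ∀ i t, 0 ≤ α i t ∧ α i t ≤ β i t ∧ β i t ≤ 1)
    (hαbar : ∀ i, MISOBC.HasWindowAverage (α i) (αbar i))
    (hβbar : ∀ i, MISOBC.HasWindowAverage (β i) (βbar i)) :
    {d : Fin 2 → ℝ | 0 ≤ d 0 ∧ 0 ≤ d 1 ∧ d 0 ≤ 1 ∧ d 1 ≤ 1 ∧
        2 * d 0 + d 1 ≤ 2 + αbar 0 ∧ 2 * d 1 + d 0 ≤ 2 + αbar 1 ∧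
        d 0 + d 1 ≤ 1 + min (βbar 0) (βbar 1)} ⊆
      MISOBC.dofRegion S := by
  rintro d ⟨hd0, hd1, hd0', hd1', h2, h3, h4⟩
  refine MISOBC.mem_dofRegion_of_eventually S (Fin.forall_fin_two.2 ⟨hd0, hd1⟩) ?_
  intro ε hε hε1
  have hd' : ∀ i, d i ≤ 1 := Fin.forall_fin_two.2 ⟨hd0', hd1'⟩
  obtain ⟨dbar, C, hdbar, hdb, hC, hCd, hCsum⟩ := MISOBC.exists_rate_split (ε := ε / 4)
    (by positivity) (by linarith)
    (fun i => (hβbar i).nonneg fun t => (hrange i t).1.trans (hrange i t).2.1)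
    (fun i => (hαbar i).nonneg fun t => (hrange i t).1) hd0' hd1' h2 h3 h4
  obtain ⟨b, hb⟩ := S.exists_directions
  choose δ hδ hδavg hqavg using fun i => MISOBC.exists_power_profile
    (fun t => ⟨(hrange i t).1, (hrange i t).2.1⟩) (hαbar i) (hβbar i) hdbar (hdb i)
  -- With `ε' = ε / 24`, the codebook slack `3 * ε' + 20 * κ` equals the `ε / 4` left by the rate
  -- split, and the rate loss `2 * ε' + 18 * κ` stays below `ε / 4`.
  set κ : ℝ := ε / 160 with hκdef
  have hκ : 0 < κ := by positivity
  set ε' : ℝ := ε / 24 with hε'def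
  have hε' : 0 < ε' := by positivity
  choose T₁ hT₁ using fun i => (hδavg i).exists_sum_bounds hε'
  choose T₂ hT₂ using fun i => (hqavg i).exists_sum_bounds hε'
  obtain ⟨T, hT1, hTη, hTδ, hTq⟩ : ∃ T : ℕ, 1 ≤ T ∧ 4 * (η : ℝ) ≤ ε * T ∧ (∀ i, T₁ i ≤ T) ∧
      ∀ i, T₂ i ≤ T := by
    have e : ∀ᶠ T : ℕ in Filter.atTop, 1 ≤ T ∧ 4 * (η : ℝ) / ε ≤ T ∧ (∀ i, T₁ i ≤ T) ∧
        ∀ i, T₂ i ≤ T := by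
      filter_upwards [Filter.eventually_ge_atTop 1,
        (tendsto_natCast_atTop_atTop (R := ℝ)).eventually_ge_atTop (4 * (η : ℝ) / ε),
        Filter.eventually_all.2 fun i => Filter.eventually_ge_atTop (T₁ i),
        Filter.eventually_all.2 fun i => Filter.eventually_ge_atTop (T₂ i)] with T a1 a2 a3 a4
      exact ⟨a1, a2, a3, a4⟩
    obtain ⟨T, a1, a2, a3, a4⟩ := e.exists
    rw [div_le_iff₀ hε] at a2
    exact ⟨T, a1, by linarith, a3, a4⟩
  filter_upwards [MISOBC.exists_block_count hε hT1 hTη] with n ⟨hn0, N, hN, hNT⟩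
  let G : ℝ → Ω → Prop := fun P ω => ∀ t : Fin n, MISOBC.GoodSlot (P ^ κ)
    (fun k => P ^ (δ k t / 2)) (fun k => P ^ (max (δ k t - α k t) 0 / 2))
    (fun k => MISOBC.eff b (S.H k t ω)) (fun k => MISOBC.eff b (S.Hhat P k t t ω))
    (fun k => MISOBC.eff b (S.Hhat P k t (t + η) ω))
  have hG : MISOBC.HighProb μ G := MISOBC.HighProb.forall fun t =>
    MISOBC.highProb_goodSlot S hκ (hb t).1 (hb t).2 (fun i => hα i t) (fun i => hβ i t)
      fun i => (hδ i t).2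
  refine ⟨fun P => μ {ω | G P ω}ᶜ + MISOBC.noiseLaw n {z | ∀ i t, ‖z i t‖ ≤ P ^ κ}ᶜ, ?_, ?_⟩
  · have := hG.add (MISOBC.highProb_noise_le n hκ)
    rwa [add_zero] at this
  filter_upwards [Filter.eventually_gt_atTop 1,
    (tendsto_rpow_atTop hκ).eventually_ge_atTop 8100,
    (tendsto_rpow_atTop hκ).eventually_ge_atTop (5 * (‖b 0‖ + ‖b 1‖))] with P hP hB hbB
  have hP0 : 0 < P := by linarith
  have hβ1 : ∀ i t, δ i t ≤ 1 := fun i t => (hδ i t).2.trans (hrange i t).2.2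
  obtain ⟨m, c, hpow, herr, hm⟩ := MISOBC.exists_blockMarkov_code S b (P := P) (B := P ^ κ) hP0.le
    (by linarith) hbB (A := fun k t => P ^ (δ k t / 2))
    (A' := fun k t => P ^ (max (δ k t - α k t) 0 / 2))
    (fun k t => Real.rpow_le_rpow_of_exponent_le hP.le (by
      have := max_le (show δ k t - α k t ≤ δ k t by linarith [(hrange k t).1]) (hδ k t).1
      linarith))
    (fun k t => Real.one_le_rpow hP.le (by linarith [le_max_right (δ k t - α k t) 0]))
    (fun k t => by
      rw [Real.sqrt_eq_rpow]
      exact Real.rpow_le_rpow_of_exponent_le hP.le (by linarith [hβ1 k t]))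
    hN (K := fun i => ⌈P ^ (T * C i)⌉₊) (fun i => Nat.ceil_pos.2 (by positivity))
    (fun s _ => MISOBC.codebook_size_le (q := fun k => max (dbar - αbar k) 0) (ε' := ε')
      (dbar := dbar) hP.le hT1 hκ (by linarith) hC (fun k j => le_max_right _ _)
      (fun k j => (hδ k _).1) (fun k => (hT₂ k T (hTq k) _).2) (fun k => (hT₁ k T (hTδ k) _).2)
      (by linarith))
    {ω | G P ω} (fun ω hω t ht => hω ⟨t, ht⟩)
  refine ⟨m, c, hpow, fun i => ?_, herr⟩
  have hlogP : 0 < Real.logb 2 P := Real.logb_pos (by norm_num) hP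
  set X : ℝ := C i + dbar + max (dbar - αbar (1 - i)) 0 - 2 * ε' - 18 * κ with hX
  have hXd : d i - ε / 2 ≤ X := by linarith [hCd i]
  have hmX : P ^ (N * (T * X)) ≤ (m i : ℝ) := by
    refine le_trans ?_ (hm i)
    calc P ^ (N * (T * X)) = ∏ _s : Fin N, P ^ (T * X) := by
          rw [Finset.prod_const, Finset.card_univ, Fintype.card_fin, mul_comm,
            Real.rpow_mul hP0.le, Real.rpow_natCast]
      _ ≤ _ := Finset.prod_le_prod (fun s _ => by positivity) fun s _ =>
          MISOBC.le_block_message_count hP.le hB (hT₂ _ T (hTq _) _).1 (hT₁ _ T (hTδ _) _).1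
  have hm0 : 0 < (m i : ℝ) := lt_of_lt_of_le (by positivity) hmX
  have hm1 : (1 : ℝ) ≤ m i := by exact_mod_cast hm0
  have hn0' : (0 : ℝ) < n := by exact_mod_cast hn0
  rw [le_div_iff₀ hn0']
  rcases le_or_gt (d i - ε) 0 with hneg | hpos
  · have h5 : (d i - ε) * Real.logb 2 P * n ≤ 0 :=
      mul_nonpos_of_nonpos_of_nonneg (mul_nonpos_of_nonpos_of_nonneg hneg hlogP.le) hn0'.le
    exact h5.trans (Real.logb_nonneg (by norm_num) hm1)
  · have h5 : N * (T * X) * Real.logb 2 P ≤ Real.logb 2 (m i) := by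
      rw [← Real.logb_rpow_eq_mul_logb_of_pos hP0]
      exact Real.logb_le_logb_of_le (by norm_num) (by positivity) hmX
    refine le_trans ?_ h5
    have h6 : (d i - ε) * n ≤ N * (T * X) := by
      push_cast at hNT
      -- Idle slots and unused blocks cost a factor `1 - ε / 2`; since `d i ≤ 1`, this loses at most
      -- another `ε / 2`.
      calc (d i - ε) * n ≤ (n * (1 - ε / 2)) * (d i - ε / 2) := by
            nlinarith [mul_nonneg hn0'.le (mul_nonneg hε.le (sub_nonneg.2 (hd' i))),
              mul_nonneg hn0'.le (sq_nonneg ε)]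
        _ ≤ (N * T) * X := mul_le_mul hNT hXd (by linarith) (by positivity)
        _ = _ := by ring
    nlinarith
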